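/- Let $k$ be a field, $d\ge 1$ and $n\ge 0$ integers, $p_1,\dots,p_n\ge 2$ integers, and let $\ell_1,\dots,\ell_n\in k[T_0,\dots,T_d]$ be linear forms in general position, i.e. any at most $d+1$ of them are linearly independent. Let $\mathbb{L}$ be the abelian group generated by $\vec{x}_1,\dots,\vec{x}_n,\vec{c}$ with relations $p_i\vec{x}_i=\vec{c}$ for $1\le i\le n$, and let \[R=k[T_0,\dots,T_d,X_1,\dots,X_n]/(X_i^{p_i}-\ell_i\mid 1\le i\le n),\] which is $\mathbb{L}$-graded by $\deg T_j=\vec{c}$ and $\deg X_i=\vec{x}_i$. Let $\mathbb{L}_+$ be the submonoid of $\mathbb{L}$ generated by $\vec{c},\vec{x}_1,\dots,\vec{x}_n$, and order $\mathbb{L}$ by $\vec{x}\le\vec{y}$ if and only if $\vec{y}-\vec{x}\in\mathbb{L}_+$; write $[0,\vec{x}]$ for the (finite) interval. For a finite subset $I\subset\mathbb{L}$ let $A^I=\bigoplus_{\vec{x},\vec{y}\in I}R_{\vec{x}-\vec{y}}$ be the $k$-algebra with matrix multiplication $(rr')_{\vec{x},\vec{y}}=\sum_{\vec{z}\in I}r_{\vec{x},\vec{z}}\,r'_{\vec{z},\vec{y}}$.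 Let $\vec{\omega}=(n-d-1)\vec{c}-\sum_{i=1}^n\vec{x}_i$ and $A^{\rm CM}=A^{[0,\,d\vec{c}+2\vec{\omega}]}$. Global dimension is that of right modules. Every element of $\mathbb{L}$ can be written uniquely in normal form $a\vec{c}+\sum_{i=1}^n a_i\vec{x}_i$ with $a\in\mathbb{Z}$ and $0\le a_i\le p_i-1$. (a) Let $\vec{x}\in\mathbb{L}_+$ have normal form $\vec{x}=a\vec{c}+\sum_{i=1}^na_i\vec{x}_i$. Then \[\operatorname{gl.dim}A^{[0,\vec{x}]}=\begin{cases}\min\{d+1,\ a+\#\{i\mid a_i\ne 0\}\}&\text{if } n\le d+1,\\ 2a+\#\{i\mid a_i\ne 0\}&\text{if } n\ge d+2.\end{cases}\] (b) If $n\ge d+2$, then $\operatorname{gl.dim}A^{\rm CM}=2(n-d-2)+\#\{i\mid p_i\ge 3\}$. -/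

import Mathlib

universe u

open CategoryTheory

/-- The (right) global dimension of a ring `A`: the supremum of the projective dimensions of all
right `A`-modules, a right `A`-module being a module over the opposite ring `Aᵐᵒᵖ`. -/
noncomputable def rightGlobalDimension (A : Type u) [Ring A] : WithBot ℕ∞ :=
  ⨆ M : ModuleCat.{u} Aᵐᵒᵖ, projectiveDimension M

/-- The data defining a Geigle-Lenzing complete intersection over the field `k`: weights
`p₁, …, pₙ ≥ 2` and linear forms `ℓ₁, …, ℓₙ` in `k[T₀, …, T_d]` in general position, that is,
any at most `d + 1` of them are linearly independent. -/
structure GLData (k : Type u) [Field k] (d n : ℕ) where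
  /-- the weights -/
  p : Fin n → ℕ
  two_le_p : ∀ i, 2 ≤ p i
  /-- the linear forms -/
  ell : Fin n → MvPolynomial (Fin (d + 1)) k
  ell_linear : ∀ i, (ell i).IsHomogeneous 1
  general_position : ∀ s : Finset (Fin n), s.card ≤ d + 1 →
    LinearIndependent k (fun i : s => ell i)

namespace GLData

variable {k : Type u} [Field k] {d n : ℕ} (D : GLData k d n)

/-! ### The grading group -/

/-- The subgroup of the free abelian group on `x₁, …, xₙ, c` (where `some i` stands for `xᵢ`, and
`none` for `c`) generated by the elements `pᵢ xᵢ - c`. -/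
def relations : AddSubgroup (FreeAbelianGroup (Option (Fin n))) :=
  AddSubgroup.closure (Set.range fun i : Fin n =>
    D.p i • FreeAbelianGroup.of (some i) - FreeAbelianGroup.of none)

/-- The abelian group `L = ⟨x₁, …, xₙ, c⟩ / ⟨pᵢ xᵢ - c⟩`. -/
def L : Type := FreeAbelianGroup (Option (Fin n)) ⧸ D.relations

noncomputable instance : AddCommGroup D.L :=
  inferInstanceAs (AddCommGroup (FreeAbelianGroup (Option (Fin n)) ⧸ D.relations))

noncomputable instance : DecidableEq D.L := Classical.decEq _

/-- The generator `xᵢ` of `L`. -/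
def x (i : Fin n) : D.L := QuotientAddGroup.mk (s := D.relations) (FreeAbelianGroup.of (some i))

/-- The generator `c` of `L`. -/
def c : D.L := QuotientAddGroup.mk (s := D.relations) (FreeAbelianGroup.of none)

theorem p_smul_x (i : Fin n) : D.p i • D.x i = D.c := by
  have h : (QuotientAddGroup.mk (s := D.relations)
      (D.p i • FreeAbelianGroup.of (some i) - FreeAbelianGroup.of none)) = 0 :=
    (QuotientAddGroup.eq_zero_iff _).2 (AddSubgroup.subset_closure ⟨i, rfl⟩)
  exact sub_eq_zero.1 h

/-- The universal property of `L`. -/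
noncomputable def lift {G : Type*} [AddCommGroup G] (f : Fin n → G) (g : G) (h : ∀ i, D.p i • f i = g) :
    D.L →+ G :=
  QuotientAddGroup.lift D.relations
    (FreeAbelianGroup.lift fun o : Option (Fin n) => o.elim g f) (by
      rw [relations, AddSubgroup.closure_le]
      rintro _ ⟨i, rfl⟩
      simp [h])

@[simp] theorem lift_x {G : Type*} [AddCommGroup G] (f : Fin n → G) (g : G)
    (h : ∀ i, D.p i • f i = g) (i : Fin n) : D.lift f g h (D.x i) = f i := by
  change FreeAbelianGroup.lift _ (FreeAbelianGroup.of (some i)) = _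
  simp

@[simp] theorem lift_c {G : Type*} [AddCommGroup G] (f : Fin n → G) (g : G)
    (h : ∀ i, D.p i • f i = g) : D.lift f g h D.c = g := by
  change FreeAbelianGroup.lift _ (FreeAbelianGroup.of none) = _
  simp

/-- The submonoid `L₊` of `L` generated by `c` and all `xᵢ`. -/
noncomputable def Lpos : AddSubmonoid D.L := AddSubmonoid.closure (insert D.c (Set.range D.x))

theorem mem_Lpos {y : D.L} (hy : y ∈ D.Lpos) :
    ∃ (a : ℕ) (b : Fin n → ℕ), y = a • D.c + ∑ i, b i • D.x i := by
  induction hy using AddSubmonoid.closure_induction with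
  | mem y hy =>
    rcases hy with rfl | ⟨i, rfl⟩
    · exact ⟨1, 0, by simp⟩
    · exact ⟨0, Pi.single i 1, by simp [Pi.single_apply, ite_smul]⟩
  | zero => exact ⟨0, 0, by simp⟩
  | add y z _ _ hy hz =>
    obtain ⟨a, b, rfl⟩ := hy
    obtain ⟨a', b', rfl⟩ := hz
    refine ⟨a + a', b + b', ?_⟩
    simp only [Pi.add_apply, add_smul, Finset.sum_add_distrib]
    abel

/-- The homomorphism `L → ℤ` with `c ↦ ∏ pⱼ` and `xᵢ ↦ ∏_{j ≠ i} pⱼ`. -/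
noncomputable def degZ : D.L →+ ℤ :=
  D.lift (fun i => ∏ j ∈ Finset.univ.erase i, (D.p j : ℤ)) (∏ j, (D.p j : ℤ)) (fun i => by
    rw [nsmul_eq_mul]
    exact Finset.mul_prod_erase _ (fun j => (D.p j : ℤ)) (Finset.mem_univ i))

theorem degZ_c_pos : 0 < D.degZ D.c := by
  rw [degZ, lift_c]
  exact Finset.prod_pos fun j _ => by have := D.two_le_p j; omega

theorem degZ_x_pos (i : Fin n) : 0 < D.degZ (D.x i) := by
  rw [degZ, lift_x]
  exact Finset.prod_pos fun j _ => by have := D.two_le_p j; omega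

theorem degZ_bound (a : ℕ) (b : Fin n → ℕ) :
    (a : ℤ) ≤ D.degZ (a • D.c + ∑ i, b i • D.x i) ∧
      ∀ i, (b i : ℤ) ≤ D.degZ (a • D.c + ∑ i, b i • D.x i) := by
  have hc : (a : ℤ) ≤ a * D.degZ D.c :=
    le_mul_of_one_le_right (by positivity) D.degZ_c_pos
  have hx : ∀ i, (b i : ℤ) ≤ b i * D.degZ (D.x i) := fun i =>
    le_mul_of_one_le_right (by positivity) (D.degZ_x_pos i)
  have h0 : ∀ i ∈ Finset.univ, 0 ≤ (b i : ℤ) * D.degZ (D.x i) := fun i _ =>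
    (Int.natCast_nonneg _).trans (hx i)
  simp only [map_add, map_nsmul, map_sum, nsmul_eq_mul]
  refine ⟨by linarith [Finset.sum_nonneg h0], fun i => ?_⟩
  have := Finset.single_le_sum h0 (Finset.mem_univ i)
  linarith [hx i, Int.natCast_nonneg a]

/-- The partial order on `L`: `y ≤ z` if and only if `z - y ∈ L₊`. -/
instance : PartialOrder D.L where
  le y z := z - y ∈ D.Lpos
  le_refl y := by simp
  le_trans y z w hyz hzw := by simpa using add_mem hzw hyz
  le_antisymm y z hyz hzy := by
    obtain ⟨a, b, hab⟩ := D.mem_Lpos hyz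
    obtain ⟨a', b', hab'⟩ := D.mem_Lpos hzy
    have h1 := D.degZ_bound a b
    have h2 := D.degZ_bound a' b'
    rw [← hab, map_sub] at h1
    rw [← hab', map_sub] at h2
    have ha : a = 0 := by omega
    have hb : ∀ i, b i = 0 := fun i => by have := h1.2 i; omega
    have : z - y = 0 := by rw [hab]; simp [ha, hb]
    exact (sub_eq_zero.1 this).symm

theorem le_iff {y z : D.L} : y ≤ z ↔ z - y ∈ D.Lpos := Iff.rfl

theorem finite_Icc (y z : D.L) : (Set.Icc y z).Finite := by
  set N : ℕ := (D.degZ (z - y)).toNat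
  refine Set.Finite.subset (Set.finite_range
    fun q : Fin (N + 1) × (Fin n → Fin (N + 1)) =>
      y + ((q.1 : ℕ) • D.c + ∑ i, (q.2 i : ℕ) • D.x i)) ?_
  rintro w ⟨hyw, hwz⟩
  obtain ⟨a, b, hab⟩ := D.mem_Lpos hyw
  obtain ⟨a', b', hab'⟩ := D.mem_Lpos hwz
  have h1 := D.degZ_bound a b
  have h2 := D.degZ_bound a' b'
  rw [← hab, map_sub] at h1
  rw [← hab', map_sub] at h2
  have hN : (N : ℤ) = max (D.degZ z - D.degZ y) 0 := by rw [← map_sub]; exact Int.toNat_eq_max _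
  refine ⟨(⟨a, by omega⟩, fun i => ⟨b i, by have := h1.2 i; omega⟩), ?_⟩
  simp only [← hab]
  abel

noncomputable instance : LocallyFiniteOrder D.L := LocallyFiniteOrder.ofFiniteIcc D.finite_Icc

/-- `y = a c + ∑ aᵢ xᵢ` with `a ∈ ℤ` and `0 ≤ aᵢ ≤ pᵢ - 1` (here `b i` is `aᵢ`). -/
def IsNormalForm (y : D.L) (a : ℤ) (b : Fin n → ℕ) : Prop :=
  (∀ i, b i < D.p i) ∧ y = a • D.c + ∑ i, b i • D.x i

theorem exists_isNormalForm (y : D.L) : ∃ a b, D.IsNormalForm y a b := by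
  have key : ∀ y : D.L, ∃ (a : ℤ) (b : Fin n → ℤ), y = a • D.c + ∑ i, b i • D.x i := by
    intro y
    obtain ⟨f, rfl⟩ := QuotientAddGroup.mk_surjective (s := D.relations) y
    induction f using FreeAbelianGroup.induction_on with
    | zero => exact ⟨0, 0, by simp; rfl⟩
    | of o =>
      cases o with
      | none => exact ⟨1, 0, by simp; rfl⟩
      | some i => exact ⟨0, Pi.single i 1, by simp [Pi.single_apply, ite_smul]; rfl⟩
    | neg o ih =>
      obtain ⟨a, b, h⟩ := ih
      refine ⟨-a, -b, ?_⟩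
      rw [QuotientAddGroup.mk_neg]
      refine (congrArg Neg.neg h).trans ?_
      simp only [Pi.neg_apply, neg_smul, Finset.sum_neg_distrib]
      abel
    | add f g hf hg =>
      obtain ⟨a, b, h⟩ := hf
      obtain ⟨a', b', h'⟩ := hg
      refine ⟨a + a', b + b', ?_⟩
      rw [QuotientAddGroup.mk_add]
      refine (congrArg₂ (fun s t : D.L => s + t) h h').trans ?_
      simp only [Pi.add_apply, add_smul, Finset.sum_add_distrib]
      abel
  obtain ⟨a, b, rfl⟩ := key y
  have hp : ∀ i, (D.p i : ℤ) ≠ 0 := fun i => by have := D.two_le_p i; omega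
  refine ⟨a + ∑ i, b i / D.p i, fun i => (b i % D.p i).toNat, fun i => ?_, ?_⟩
  · have := Int.emod_lt_of_pos (b i) (show (0 : ℤ) < D.p i by have := D.two_le_p i; omega)
    have := Int.emod_nonneg (b i) (hp i)
    change (b i % (D.p i : ℤ)).toNat < D.p i
    omega
  · rw [add_smul, Finset.sum_smul, add_assoc, ← Finset.sum_add_distrib]
    congr 1
    refine Finset.sum_congr rfl fun i _ => ?_
    rw [← natCast_zsmul, Int.toNat_of_nonneg (Int.emod_nonneg _ (hp i)), ← D.p_smul_x i,
      ← natCast_zsmul, ← mul_smul, ← add_smul]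
    congr 1
    rw [mul_comm]
    exact (Int.mul_ediv_add_emod _ _).symm

theorem isNormalForm_unique {y : D.L} {a a' : ℤ} {b b' : Fin n → ℕ}
    (h : D.IsNormalForm y a b) (h' : D.IsNormalForm y a' b') : a = a' ∧ b = b' := by
  have hb : b = b' := by
    funext i
    let φ : D.L →+ ZMod (D.p i) := D.lift (Pi.single i 1) 0 (fun j => by
      by_cases hj : j = i
      · subst hj; simp
      · simp [hj])
    have e : ∀ (a : ℤ) (b : Fin n → ℕ), φ (a • D.c + ∑ i, b i • D.x i) = (b i : ZMod (D.p i)) := by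
      intro a b
      simp [φ, Pi.single_apply]
    have := (e a b).symm.trans ((congrArg φ (h.2.symm.trans h'.2)).trans (e a' b'))
    rw [ZMod.natCast_eq_natCast_iff] at this
    exact this.eq_of_lt_of_lt (h.1 i) (h'.1 i)
  subst hb
  refine ⟨?_, rfl⟩
  have := congrArg D.degZ (add_right_cancel (h.2.symm.trans h'.2))
  rw [map_zsmul, map_zsmul, smul_eq_mul, smul_eq_mul] at this
  exact mul_right_cancel₀ D.degZ_c_pos.ne' this

/-- The element `ω = (n - d - 1) c - ∑ xᵢ` of `L`. -/
noncomputable def omega : D.L := ((n : ℤ) - d - 1) • D.c - ∑ i, D.x i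

/-! ### The graded ring -/

/-- The polynomial ring `k[T₀, …, T_d, X₁, …, Xₙ]`. -/
abbrev Poly (_ : GLData k d n) : Type u := MvPolynomial (Fin (d + 1) ⊕ Fin n) k

/-- The ideal generated by all `Xᵢ ^ pᵢ - ℓᵢ(T₀, …, T_d)`. -/
noncomputable def relIdeal : Ideal D.Poly :=
  Ideal.span (Set.range fun i : Fin n =>
    MvPolynomial.X (Sum.inr i) ^ D.p i - MvPolynomial.rename Sum.inl (D.ell i))

/-- The ring `R = k[T₀, …, T_d, X₁, …, Xₙ] / (Xᵢ ^ pᵢ - ℓᵢ)`. -/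
abbrev R : Type u := D.Poly ⧸ D.relIdeal

/-- The degrees of the variables: `deg Tⱼ = c` and `deg Xᵢ = xᵢ`. -/
def weight : Fin (d + 1) ⊕ Fin n → D.L := Sum.elim (fun _ => D.c) D.x

/-- The homogeneous component `R_y` of `R` of degree `y`, the image in `R` of the polynomials that
are homogeneous of degree `y`. -/
noncomputable def component (y : D.L) : Submodule k D.R :=
  (MvPolynomial.weightedHomogeneousSubmodule k D.weight y).map
    (Ideal.Quotient.mkₐ k D.relIdeal).toLinearMap

theorem mul_mem_component {y z : D.L} {r s : D.R} (hr : r ∈ D.component y)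
    (hs : s ∈ D.component z) : r * s ∈ D.component (y + z) := by
  obtain ⟨f, hf, rfl⟩ := hr
  obtain ⟨g, hg, rfl⟩ := hs
  exact ⟨f * g, MvPolynomial.IsWeightedHomogeneous.mul hf hg, by simp⟩

theorem algebraMap_mem_component (t : k) : algebraMap k D.R t ∈ D.component 0 :=
  ⟨algebraMap k D.Poly t, MvPolynomial.isWeightedHomogeneous_C _ t, by simp⟩

/-! ### The canonical algebras -/

/-- The `I`-canonical algebra `A^I = ⨁_{y, z ∈ I} R_{y - z}` with matrix multiplication, for a
finite subset `I` of `L`, realised as the algebra of all `I × I` matrices over `R` whose entry at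
`(y, z)` lies in `R_{y - z}`. -/
noncomputable def canonicalAlgebra (I : Finset D.L) : Subalgebra k (Matrix I I D.R) where
  carrier := {M | ∀ y z : I, M y z ∈ D.component (y - z)}
  mul_mem' {M N} hM hN y z := by
    rw [Matrix.mul_apply]
    refine Submodule.sum_mem _ fun w _ => ?_
    have := D.mul_mem_component (hM y w) (hN w z)
    rwa [sub_add_sub_cancel] at this
  add_mem' hM hN y z := Submodule.add_mem _ (hM y z) (hN y z)
  algebraMap_mem' t y z := by
    rw [Matrix.algebraMap_matrix_apply]
    split_ifs with h
    · subst h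
      rw [sub_self]
      exact D.algebraMap_mem_component t
    · exact Submodule.zero_mem _

/-- The CM-canonical algebra `A^CM = A^{[0, d c + 2 ω]}`. -/
noncomputable abbrev cmCanonicalAlgebra :
    Subalgebra k (Matrix (Finset.Icc (0 : D.L) (d • D.c + 2 • D.omega))
      (Finset.Icc (0 : D.L) (d • D.c + 2 • D.omega)) D.R) :=
  D.canonicalAlgebra (Finset.Icc 0 (d • D.c + 2 • D.omega))

end GLData

/-! For a homogeneous ideal `K`, the graded module `(R/K)(w)` restricts to a right `A^I`-module `z ↦
(R/K)_{w-z}`, and restriction is exact. Let `I = [0, y]`. If `w ≤ y`, then either `w ∈ I` and `R(w)`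
restricts to the projective `e_w A^I`, or nothing in `I` lies below `w` and `R(w)` restricts to
zero. So a graded free resolution of `k(w)`, where `k` is the residue field `R/M`, restricts to a
projective resolution of the simple module at `w`.

If `n ≤ d + 1`, then `R` is a polynomial ring in the `Xᵢ` and `d + 1 - n` linear forms. The Koszul
complex has terms of internal degree `a c + ∑_{l ∈ s} x_l` with `a ≤ d + 1 - n`, in homological
degree `a + |s|`. If `n ≥ d + 2`, then `R` is a complete intersection in the `Xᵢ` with relations of
degree `c`. The Tate resolution has the same internal degrees, with `a` now unbounded, in
homological degree `2a + |s|`. As `pᵢ ≥ 2`, these degrees are normal forms, so the internal degree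
determines `(a, s)` and hence the homological degree (`elt_inj`). This excludes cancellation.

No resolution is written down. The maximal homogeneous ideal is built one generator at a time, and
the nonzero `Ext` groups are followed through `0 → (R/(K : g))(w - deg g) → (R/K)(w) → (R/(K +
(g)))(w) → 0` (`exists_exact_cyc`). The first `d + 1` generators are regular, so `K : g = K`. Each
later `X_j` satisfies `X_j ^ p_j ∈ K`, so `X_j` and `X_j ^ (p_j - 1)` have each other as
annihilators modulo `K`. Two sequences then return to the same module, shifted by `c` and by two
homological degrees (`vanishesOutside_tate_succ`, `nonzeroOn_tate_succ`).

Every module is a finite iterated extension of modules concentrated at one vertex, and these are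
direct sums of copies of one simple module. The global dimension is therefore the largest `i` with a
nonzero `Extⁱ` between simples (`rightGlobalDimension_eq`). It remains to maximise the homological
degree over all `(a', s)` with `a' c + ∑_{l ∈ s} x_l ≤ y`. Using an `x_l` absent from the normal
form of `y` costs one `c`. This trade loses when `c` counts twice, and is neutral when `c` counts
once. -/

section ExtNonzero

/-! ### Long exact sequences as statements on nonvanishing of Ext -/

open CategoryTheory.Abelian

variable {B : Type u} [Ring B]

/-- `Extⁱ(M, N)` is nonzero. -/
def ExtNonzero (M N : ModuleCat.{u} B) (i : ℕ) : Prop :=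
  ∃ e : Ext M N i, e ≠ 0

theorem not_extNonzero {M N : ModuleCat.{u} B} {i : ℕ} :
    ¬ ExtNonzero M N i ↔ ∀ e : Ext M N i, e = 0 := by
  simp [ExtNonzero]

/-- Exactness of `Extⁱ⁻¹(X₁, N) → Extⁱ(X₃, N) → Extⁱ(X₂, N)`. This and the next two lemmas are the
three exact spots of the contravariant sequence, in the form used for tracking degrees. -/
theorem ExtNonzero.of_X₃ {S : ShortComplex (ModuleCat.{u} B)} (hS : S.ShortExact)
    {N : ModuleCat.{u} B} {i : ℕ} (h : ExtNonzero S.X₃ N i) :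
    ExtNonzero S.X₂ N i ∨ ∃ j, i = j + 1 ∧ ExtNonzero S.X₁ N j := by
  by_contra! hc
  obtain ⟨hc₂, hc₁⟩ := hc
  obtain ⟨e, he⟩ := h
  have h0 : (Ext.mk₀ S.g).comp e (zero_add i) = 0 := not_extNonzero.1 hc₂ _
  -- In degree zero there is no connecting map; `Hom(X₃, N)` embeds in `Hom(X₂, N)` because `S.g` is
  -- epi.
  rcases i with _ | i
  · refine he ?_
    obtain ⟨f, rfl⟩ := Ext.homEquiv₀.symm.surjective e
    have := hS.epi_g
    rw [Ext.homEquiv₀_symm_apply, Ext.mk₀_comp_mk₀] at h0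
    rw [Ext.homEquiv₀_symm_apply]
    have h1 : S.g ≫ f = 0 := Ext.homEquiv₀.symm.injective (by simpa using h0)
    rw [Limits.zero_of_epi_comp S.g h1, Ext.mk₀_zero]
  · obtain ⟨x, rfl⟩ := Ext.contravariant_sequence_exact₃ hS N e h0 (add_comm 1 i)
    rw [not_extNonzero.1 (hc₁ i rfl) x, Ext.comp_zero] at he
    exact he rfl

theorem ExtNonzero.X₃_of_X₁ {S : ShortComplex (ModuleCat.{u} B)} (hS : S.ShortExact)
    {N : ModuleCat.{u} B} {i : ℕ} (h : ExtNonzero S.X₁ N i) (h₂ : ¬ ExtNonzero S.X₂ N i) :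
    ExtNonzero S.X₃ N (i + 1) := by
  by_contra hc
  obtain ⟨e, he⟩ := h
  obtain ⟨x, rfl⟩ := Ext.contravariant_sequence_exact₁ hS N e (add_comm 1 i)
    (not_extNonzero.1 hc _)
  rw [not_extNonzero.1 h₂ x, Ext.comp_zero] at he
  exact he rfl

theorem ExtNonzero.X₃_of_X₂ {S : ShortComplex (ModuleCat.{u} B)} (hS : S.ShortExact)
    {N : ModuleCat.{u} B} {i : ℕ} (h : ExtNonzero S.X₂ N i) (h₁ : ¬ ExtNonzero S.X₁ N i) :
    ExtNonzero S.X₃ N i := by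
  by_contra hc
  obtain ⟨e, he⟩ := h
  obtain ⟨x, rfl⟩ := Ext.contravariant_sequence_exact₂ hS N e (not_extNonzero.1 h₁ _)
  rw [not_extNonzero.1 hc x, Ext.comp_zero] at he
  exact he rfl

theorem ExtNonzero.of_covariant_X₂ {S : ShortComplex (ModuleCat.{u} B)} (hS : S.ShortExact)
    {M : ModuleCat.{u} B} {i : ℕ} (h : ExtNonzero M S.X₂ i) :
    ExtNonzero M S.X₁ i ∨ ExtNonzero M S.X₃ i := by
  by_contra! hc
  obtain ⟨e, he⟩ := h
  obtain ⟨x, rfl⟩ := Ext.covariant_sequence_exact₂ M hS e (not_extNonzero.1 hc.2 _)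
  rw [not_extNonzero.1 hc.1 x, Ext.zero_comp] at he
  exact he rfl

theorem extNonzero_zero_iff {M N : ModuleCat.{u} B} :
    ExtNonzero M N 0 ↔ ∃ f : M →ₗ[B] N, f ≠ 0 := by
  constructor
  · rintro ⟨e, he⟩
    obtain ⟨f, rfl⟩ := Ext.homEquiv₀.symm.surjective e
    refine ⟨f.hom, fun h => he ?_⟩
    have : f = 0 := by ext1; exact h
    rw [this, Ext.homEquiv₀_symm_apply, Ext.mk₀_zero]
  · rintro ⟨f, hf⟩
    refine ⟨Ext.mk₀ (ModuleCat.ofHom f), fun h => hf ?_⟩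
    have : ModuleCat.ofHom f = 0 := Ext.homEquiv₀.symm.injective (by simpa using h)
    exact congrArg ModuleCat.Hom.hom this

theorem ExtNonzero.eq_zero_of_projective {M N : ModuleCat.{u} B} [Module.Projective B M] {i : ℕ}
    (h : ExtNonzero M N i) : i = 0 := by
  have : Projective M := (IsProjective.iff_projective M).1 inferInstance
  by_contra hi
  obtain ⟨e, he⟩ := h
  exact he (e.eq_zero_of_hasProjectiveDimensionLT 1 (by omega))

theorem hasProjectiveDimensionLT_iff_extNonzero {M : ModuleCat.{u} B} {s : ℕ} :
    HasProjectiveDimensionLT M s ↔ ∀ i, s ≤ i → ∀ N : ModuleCat.{u} B, ¬ ExtNonzero M N i := by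
  simp only [hasProjectiveDimensionLT_iff, not_extNonzero]

/-- The short complex attached to two composable linear maps. -/
abbrev linearShortComplex {M₁ M₂ M₃ : Type u} [AddCommGroup M₁] [AddCommGroup M₂] [AddCommGroup M₃]
    [Module B M₁] [Module B M₂] [Module B M₃] (f : M₁ →ₗ[B] M₂) (g : M₂ →ₗ[B] M₃)
    (h : Function.Exact f g) : ShortComplex (ModuleCat.{u} B) :=
  ShortComplex.mk (ModuleCat.ofHom f) (ModuleCat.ofHom g) (by ext x; exact h.apply_apply_eq_zero x)

theorem linearShortComplex_shortExact {M₁ M₂ M₃ : Type u} [AddCommGroup M₁] [AddCommGroup M₂]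
    [AddCommGroup M₃] [Module B M₁] [Module B M₂] [Module B M₃] {f : M₁ →ₗ[B] M₂}
    {g : M₂ →ₗ[B] M₃} (h : Function.Exact f g) (hf : Function.Injective f)
    (hg : Function.Surjective g) : (linearShortComplex f g h).ShortExact where
  exact := (ShortComplex.ShortExact.moduleCat_exact_iff_function_exact _).2 h
  mono_f := (ModuleCat.mono_iff_injective _).2 hf
  epi_g := (ModuleCat.epi_iff_surjective _).2 hg

theorem exact_mapRange (κ : Type u) {M₁ M₂ M₃ : Type u} [AddCommGroup M₁] [AddCommGroup M₂]
    [AddCommGroup M₃] [Module B M₁] [Module B M₂] [Module B M₃] {f : M₁ →ₗ[B] M₂}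
    {g : M₂ →ₗ[B] M₃} (h : Function.Exact f g) :
    Function.Exact (Finsupp.mapRange.linearMap (α := κ) f)
      (Finsupp.mapRange.linearMap (α := κ) g) := by
  intro x
  constructor
  · intro hx
    have hx' : ∀ i, ∃ y, f y = x i := fun i => (h _).1 (DFunLike.congr_fun hx i)
    choose y hy using hx'
    classical
    -- The chosen preimages are reset to zero off the support of `x`, which keeps the family
    -- finitely supported.
    refine ⟨Finsupp.onFinset x.support (fun i => if x i = 0 then 0 else y i)
      fun i => by by_cases hi : x i = 0 <;> simp [hi], Finsupp.ext fun i => ?_⟩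
    by_cases hi : x i = 0
    · simp [hi]
    · simp [hi, hy]
  · rintro ⟨y, rfl⟩
    exact Finsupp.ext fun i => by simp [h.apply_apply_eq_zero]

theorem finsuppShortComplex_shortExact (κ : Type u) {M₁ M₂ M₃ : Type u} [AddCommGroup M₁]
    [AddCommGroup M₂] [AddCommGroup M₃] [Module B M₁] [Module B M₂] [Module B M₃]
    {f : M₁ →ₗ[B] M₂} {g : M₂ →ₗ[B] M₃} (h : Function.Exact f g) (hf : Function.Injective f)
    (hg : Function.Surjective g) : (linearShortComplex _ _ (exact_mapRange κ h)).ShortExact :=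
  linearShortComplex_shortExact _ (Finsupp.mapRange_injective f (map_zero f) hf)
    (Finsupp.mapRange_surjective g (map_zero g) hg)

/-- Dimension shifting along a free cover of `M`: its `κ`-fold sum is again exact with projective
middle term. The induction starts from zero modules and projective modules. -/
theorem hasProjectiveDimensionLT_finsupp (κ : Type u) (s : ℕ) :
    ∀ (M : Type u) [AddCommGroup M] [Module B M],
    HasProjectiveDimensionLT (ModuleCat.of B M) s →
      HasProjectiveDimensionLT (ModuleCat.of B (κ →₀ M)) s := by
  induction s with
  | zero =>
    intro M _ _ h
    rw [hasProjectiveDimensionLT_zero_iff_isZero, ModuleCat.isZero_iff_subsingleton] at *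
    have : Subsingleton M := h
    exact inferInstanceAs (Subsingleton (κ →₀ M))
  | succ s ih =>
    intro M _ _ h
    rcases s with _ | s
    · rw [← projective_iff_hasProjectiveDimensionLT_one, ← IsProjective.iff_projective] at *
      have : Module.Projective B M := h
      classical
      exact Module.Projective.of_equiv (finsuppLequivDFinsupp B : (κ →₀ M) ≃ₗ[B] _).symm
    · let p : (M →₀ B) →ₗ[B] M := Finsupp.linearCombination B id
      have hp : Function.Surjective p := Finsupp.linearCombination_id_surjective B M
      have e : Function.Exact (LinearMap.ker p).subtype p := LinearMap.exact_subtype_ker_map p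
      have hS := linearShortComplex_shortExact e (Submodule.subtype_injective _) hp
      have hS' := finsuppShortComplex_shortExact κ e (Submodule.subtype_injective _) hp
      have hproj : Projective (ModuleCat.of B (M →₀ B)) :=
        (IsProjective.iff_projective _).1 inferInstance
      have hproj' : Projective (ModuleCat.of B (κ →₀ M →₀ B)) :=
        (IsProjective.iff_projective _).1 inferInstance
      exact (hS'.hasProjectiveDimensionLT_X₃_iff s hproj').2
        (ih _ ((hS.hasProjectiveDimensionLT_X₃_iff s hproj).1 h))

end ExtNonzero

/-! ### `R` as a free module over `k[T]` and the coefficients of normal forms -/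

namespace GLData
variable {k : Type u} [Field k] {d n : ℕ} (D : GLData k d n)

/-- The polynomial ring `k[T₀, …, T_d]`. -/
abbrev S (_ : GLData k d n) : Type u := MvPolynomial (Fin (d + 1)) k

/-- The structure map `k[T₀, …, T_d] → R`. -/
noncomputable def iota : D.S →+* D.R :=
  (Ideal.Quotient.mk D.relIdeal).comp (MvPolynomial.rename Sum.inl : D.S →ₐ[k] D.Poly).toRingHom

/-- The class of the variable `Xᵢ` in `R`. -/
noncomputable def xR (i : Fin n) : D.R :=
  Ideal.Quotient.mk D.relIdeal (MvPolynomial.X (Sum.inr i))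

theorem xR_pow (i : Fin n) : D.xR i ^ D.p i = D.iota (D.ell i) := by
  rw [xR, ← map_pow]
  exact Ideal.Quotient.eq.2 (Ideal.subset_span ⟨i, rfl⟩)

/-- `k[T, X]` as a polynomial ring in the `Xᵢ` over `k[T]`. -/
noncomputable def sumHom : D.Poly →ₐ[k] MvPolynomial (Fin n) D.S :=
  MvPolynomial.aeval
    (Sum.elim (fun j => MvPolynomial.C (MvPolynomial.X j)) fun i => MvPolynomial.X i)

theorem sumHom_rename (f : D.S) : D.sumHom (MvPolynomial.rename Sum.inl f) = MvPolynomial.C f := by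
  rw [sumHom, MvPolynomial.aeval_rename]
  have : (Sum.elim (fun j => MvPolynomial.C (MvPolynomial.X j)) fun i => MvPolynomial.X i) ∘ Sum.inl
    = fun j => (MvPolynomial.C (MvPolynomial.X j) : MvPolynomial (Fin n) D.S) := rfl
  rw [this]
  induction f using MvPolynomial.induction_on with
  | C a => rw [MvPolynomial.aeval_C]; rfl
  | add p q hp hq => rw [map_add, map_add, hp, hq]
  | mul_X p i hp => rw [map_mul, map_mul, hp, MvPolynomial.aeval_X]

theorem sumHom_X (i : Fin n) : D.sumHom (MvPolynomial.X (Sum.inr i)) = MvPolynomial.X i := by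
  simp [sumHom]

/-- The `b`-th coefficient of the normal form of the monomial `X ^ m`. -/
noncomputable def monCoef (b : Fin n → ℕ) (m : Fin n →₀ ℕ) : D.S :=
  open Classical in
  if (fun i => m i % D.p i) = b then ∏ i, D.ell i ^ (m i / D.p i) else 0

/-- The `b`-th coefficient of the normal form, on polynomials. -/
noncomputable def polyCoef (b : Fin n → ℕ) : MvPolynomial (Fin n) D.S →ₗ[D.S] D.S :=
  (MvPolynomial.basisMonomials (Fin n) D.S).constr D.S (D.monCoef b)

theorem polyCoef_monomial (b : Fin n → ℕ) (m : Fin n →₀ ℕ) (f : D.S) :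
    D.polyCoef b (MvPolynomial.monomial m f) = f * D.monCoef b m := by
  have h : MvPolynomial.monomial m f = f • (MvPolynomial.monomial m (1 : D.S)) := by
    rw [MvPolynomial.smul_monomial, smul_eq_mul, mul_one]
  have h1 : MvPolynomial.monomial m (1 : D.S) = MvPolynomial.basisMonomials (Fin n) D.S m := by
    rw [MvPolynomial.coe_basisMonomials]
  rw [h, map_smul, smul_eq_mul, h1, polyCoef, Module.Basis.constr_basis]

theorem p_pos (i : Fin n) : 0 < D.p i := by have := D.two_le_p i; omega

theorem monCoef_add_p (b : Fin n → ℕ) (m : Fin n →₀ ℕ) (i : Fin n) :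
    D.monCoef b (m + Finsupp.single i (D.p i)) = D.ell i * D.monCoef b m := by
  have h1 : (fun j => (m + Finsupp.single i (D.p i)) j % D.p j) = fun j => m j % D.p j := by
    funext j
    by_cases hj : i = j
    · subst hj; simp
    · simp [hj]
  have h2 : ∏ j, D.ell j ^ ((m + Finsupp.single i (D.p i)) j / D.p j) =
      D.ell i * ∏ j, D.ell j ^ (m j / D.p j) := by
    rw [← Finset.mul_prod_erase _ _ (Finset.mem_univ i),
      ← Finset.mul_prod_erase Finset.univ (fun j => D.ell j ^ (m j / D.p j)) (Finset.mem_univ i),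
      ← mul_assoc, ← pow_succ']
    congr 1
    · simp [Nat.add_div_right _ (D.p_pos i)]
    · refine Finset.prod_congr rfl fun j hj => ?_
      rw [Finset.mem_erase] at hj
      simp [Ne.symm hj.1]
  rw [monCoef, monCoef, h1, h2]
  split_ifs <;> simp

/-- Combined with linearity over `k[T]`, this shows that `polyCoef b` kills all multiples of `Xᵢ ^
pᵢ - ℓᵢ`, so it descends to `R`. -/
theorem polyCoef_X_pow_mul (b : Fin n → ℕ) (i : Fin n) (q : MvPolynomial (Fin n) D.S) :
    D.polyCoef b (q * MvPolynomial.X i ^ D.p i) = D.ell i * D.polyCoef b q := by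
  induction q using MvPolynomial.induction_on' with
  | monomial m f =>
    rw [MvPolynomial.X_pow_eq_monomial, MvPolynomial.monomial_mul, mul_one, polyCoef_monomial,
      polyCoef_monomial, monCoef_add_p]
    ring
  | add p q hp hq => rw [add_mul, map_add, map_add, hp, hq, mul_add]

theorem polyCoef_eq_zero (b : Fin n → ℕ) {q : D.Poly} (hq : q ∈ D.relIdeal) :
    D.polyCoef b (D.sumHom q) = 0 := by
  -- `polyCoef b` is not multiplicative, so the span induction carries an arbitrary multiplier.
  suffices h : ∀ r, D.polyCoef b (D.sumHom (r * q)) = 0 by simpa using h 1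
  rw [relIdeal] at hq
  induction hq using Submodule.span_induction with
  | zero => simp
  | add x y hx hy h h' => intro r; rw [mul_add, map_add, map_add, h, h', add_zero]
  | mem x hx =>
    intro r
    obtain ⟨i, rfl⟩ := hx
    rw [mul_sub, map_sub, map_sub, map_mul D.sumHom, map_mul D.sumHom, map_pow, sumHom_X,
      sumHom_rename, polyCoef_X_pow_mul, mul_comm _ (MvPolynomial.C _), ← MvPolynomial.smul_eq_C_mul, map_smul,
      smul_eq_mul, sub_self]
  | smul a x hx h => intro r; rw [smul_eq_mul, ← mul_assoc]; exact h _

/-- The `b`-th coefficient of the normal form of an element of `R`. -/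
noncomputable def coef (b : Fin n → ℕ) : D.R →+ D.S :=
  QuotientAddGroup.lift (Submodule.toAddSubgroup D.relIdeal)
    ((D.polyCoef b).toAddMonoidHom.comp D.sumHom.toRingHom.toAddMonoidHom)
    fun _ hq => D.polyCoef_eq_zero b hq

theorem coef_mk (b : Fin n → ℕ) (q : D.Poly) :
    D.coef b (Ideal.Quotient.mk D.relIdeal q) = D.polyCoef b (D.sumHom q) := rfl

theorem coef_iota_mul (b : Fin n → ℕ) (f : D.S) (r : D.R) :
    D.coef b (D.iota f * r) = f * D.coef b r := by
  obtain ⟨q, rfl⟩ := Ideal.Quotient.mk_surjective r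
  have : D.iota f = Ideal.Quotient.mk D.relIdeal (MvPolynomial.rename Sum.inl f) := rfl
  rw [this, ← map_mul, coef_mk, coef_mk, map_mul, sumHom_rename, ← MvPolynomial.smul_eq_C_mul,
    map_smul, smul_eq_mul]

/-- The monomial `X ^ b` in `R`. -/
noncomputable def mon (b : Fin n → ℕ) : D.R := ∏ i, D.xR i ^ b i

theorem exists_mon_expansion (r : D.R) :
    ∃ (s : Finset (Fin n →₀ ℕ)) (f : (Fin n →₀ ℕ) → D.S), r = ∑ m ∈ s, D.iota (f m) * D.mon m := by
  let φ : MvPolynomial (Fin n) D.S →+* D.R := MvPolynomial.eval₂Hom D.iota D.xR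
  have hφ : ∀ q, φ (D.sumHom q) = Ideal.Quotient.mk D.relIdeal q := by
    intro q
    induction q using MvPolynomial.induction_on with
    | C a =>
      have : (MvPolynomial.C a : D.Poly) = MvPolynomial.rename Sum.inl (MvPolynomial.C a : D.S) := by
        simp
      rw [this, sumHom_rename]
      exact MvPolynomial.eval₂Hom_C _ _ _
    | add p q hp hq => rw [map_add, map_add, map_add, hp, hq]
    | mul_X p i hp =>
      rw [map_mul, map_mul, map_mul, hp]
      congr 1
      rcases i with i | i
      · have : (MvPolynomial.X (Sum.inl i) : D.Poly) =
            MvPolynomial.rename Sum.inl (MvPolynomial.X i : D.S) := by simp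
        rw [this, sumHom_rename]
        exact MvPolynomial.eval₂Hom_C _ _ _
      · rw [sumHom_X]
        exact MvPolynomial.eval₂Hom_X' _ _ _
  obtain ⟨q, rfl⟩ := Ideal.Quotient.mk_surjective r
  refine ⟨(D.sumHom q).support, fun m => (D.sumHom q).coeff m, ?_⟩
  rw [← hφ]
  exact MvPolynomial.eval₂_eq' _ _ _

theorem coef_mon (b : Fin n → ℕ) (m : Fin n →₀ ℕ) : D.coef b (D.mon m) = D.monCoef b m := by
  have : D.mon m = Ideal.Quotient.mk D.relIdeal (∏ i, MvPolynomial.X (Sum.inr i) ^ m i) := by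
    simp [mon, xR]
  rw [this, coef_mk]
  simp only [map_prod, map_pow, sumHom_X]
  have : ∏ i, (MvPolynomial.X i : MvPolynomial (Fin n) D.S) ^ m i = MvPolynomial.monomial m 1 := by
    rw [MvPolynomial.monomial_eq, Finsupp.prod_fintype _ _ (by simp)]
    simp
  rw [this, polyCoef_monomial, one_mul]

/-- The exponents of reduced monomials. -/
def reduced : Finset (Fin n → ℕ) := Fintype.piFinset fun i => Finset.range (D.p i)

theorem mem_reduced {b : Fin n → ℕ} : b ∈ D.reduced ↔ ∀ i, b i < D.p i := by
  simp [reduced]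

/-- Rewriting with `Xᵢ ^ pᵢ = ℓᵢ` turns `X ^ m` into `∏ ℓᵢ ^ (mᵢ / pᵢ)` times the reduced monomial
with exponents `mᵢ % pᵢ`. -/
theorem eq_sum_coef (r : D.R) : r = ∑ b ∈ D.reduced, D.iota (D.coef b r) * D.mon b := by
  obtain ⟨s, f, rfl⟩ := D.exists_mon_expansion r
  simp only [map_sum, Finset.sum_mul]
  rw [Finset.sum_comm]
  refine Finset.sum_congr rfl fun m _ => ?_
  simp only [coef_iota_mul, coef_mon, map_mul, mul_assoc]
  rw [← Finset.mul_sum]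
  congr 1
  rw [Finset.sum_eq_single (fun i => m i % D.p i)]
  · simp only [monCoef, if_true, map_prod, map_pow, mon, ← xR_pow]
    rw [← Finset.prod_mul_distrib]
    refine Finset.prod_congr rfl fun i _ => ?_
    rw [← pow_mul, ← pow_add, Nat.div_add_mod]
  · intro b _ hb
    rw [monCoef, if_neg (Ne.symm hb), map_zero, zero_mul]
  · intro h
    exact absurd (D.mem_reduced.2 fun i => Nat.mod_lt _ (D.p_pos i)) h

theorem xR_mul_mon (i : Fin n) (m : Fin n →₀ ℕ) :
    D.xR i * D.mon m = D.mon (m + Finsupp.single i 1 : Fin n →₀ ℕ) := by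
  rw [mon, mon, ← Finset.mul_prod_erase Finset.univ (fun j => D.xR j ^ m j) (Finset.mem_univ i),
    ← Finset.mul_prod_erase Finset.univ
      (fun j => D.xR j ^ (m + Finsupp.single i 1 : Fin n →₀ ℕ) j) (Finset.mem_univ i), ← mul_assoc, ← pow_succ']
  congr 1
  · simp
  · refine Finset.prod_congr rfl fun j hj => ?_
    rw [Finset.mem_erase] at hj
    simp [Ne.symm hj.1]

/-- Multiplication by `Xᵢ` moves the exponent `bᵢ` cyclically modulo `pᵢ` and picks up a factor `ℓᵢ`
exactly when it wraps around, which is the next lemma. All colon ideals below are read off from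
these two rules. -/
theorem coef_xR_mul {b : Fin n → ℕ} {i : Fin n} (hb : b i + 1 < D.p i) (r : D.R) :
    D.coef (Function.update b i (b i + 1)) (D.xR i * r) = D.coef b r := by
  obtain ⟨s, f, rfl⟩ := D.exists_mon_expansion r
  rw [Finset.mul_sum, map_sum, map_sum]
  refine Finset.sum_congr rfl fun m _ => ?_
  rw [mul_left_comm, coef_iota_mul, coef_iota_mul, xR_mul_mon, coef_mon, coef_mon]
  congr 1
  have h0 : (fun j => (m + Finsupp.single i 1 : Fin n →₀ ℕ) j % D.p j) = Function.update b i (b i + 1) ↔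
      (fun j => m j % D.p j) = b := by
    simp only [funext_iff]
    refine forall_congr' fun j => ?_
    by_cases hj : j = i
    · subst hj
      simp only [Finsupp.add_apply, Finsupp.single_eq_same, Function.update_self]
      have := Nat.mod_lt (m j) (D.p_pos j)
      rw [Nat.add_mod_eq_ite, Nat.mod_eq_of_lt (show 1 < D.p j by omega)]
      split_ifs <;> omega
    · simp [hj]
  rw [monCoef, monCoef]
  by_cases h : (fun j => m j % D.p j) = b
  · rw [if_pos h, if_pos (h0.2 h)]
    refine Finset.prod_congr rfl fun j _ => ?_
    by_cases hj : j = i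
    · subst hj
      have h1 : m j % D.p j = b j := congrFun h j
      have : (m j + 1) / D.p j = m j / D.p j := by
        rw [Nat.add_div (D.p_pos j), Nat.div_eq_of_lt (show 1 < D.p j by omega),
          Nat.mod_eq_of_lt (show 1 < D.p j by omega), if_neg (by omega)]
        rfl
      simp [this]
    · simp [Ne.symm hj]
  · rw [if_neg h, if_neg fun h' => h (h0.1 h')]

theorem coef_xR_mul_of_last {b : Fin n → ℕ} {i : Fin n} (hb : b i + 1 = D.p i) (r : D.R) :
    D.coef (Function.update b i 0) (D.xR i * r) = D.ell i * D.coef b r := by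
  obtain ⟨s, f, rfl⟩ := D.exists_mon_expansion r
  rw [Finset.mul_sum, map_sum, map_sum, Finset.mul_sum]
  refine Finset.sum_congr rfl fun m _ => ?_
  rw [mul_left_comm, coef_iota_mul, coef_iota_mul, xR_mul_mon, coef_mon, coef_mon, mul_left_comm]
  congr 1
  have hp := D.two_le_p i
  have h0 : (fun j => (m + Finsupp.single i 1 : Fin n →₀ ℕ) j % D.p j) = Function.update b i 0 ↔
      (fun j => m j % D.p j) = b := by
    simp only [funext_iff]
    refine forall_congr' fun j => ?_
    by_cases hj : j = i
    · subst hj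
      simp only [Finsupp.add_apply, Finsupp.single_eq_same, Function.update_self]
      have := Nat.mod_lt (m j) (D.p_pos j)
      rw [Nat.add_mod_eq_ite, Nat.mod_eq_of_lt (show 1 < D.p j by omega)]
      split_ifs
      · omega
      · rw [false_iff]; intro h; omega
    · simp [hj]
  rw [monCoef, monCoef]
  by_cases h : (fun j => m j % D.p j) = b
  · rw [if_pos h, if_pos (h0.2 h), ← Finset.mul_prod_erase _ _ (Finset.mem_univ i),
      ← Finset.mul_prod_erase Finset.univ (fun j => D.ell j ^ (m j / D.p j)) (Finset.mem_univ i),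
      ← mul_assoc, ← pow_succ']
    congr 1
    · have h1 : m i % D.p i = b i := congrFun h i
      have : (m i + 1) / D.p i = m i / D.p i + 1 := by
        rw [Nat.add_div (D.p_pos i), Nat.div_eq_of_lt (show 1 < D.p i by omega),
          Nat.mod_eq_of_lt (show 1 < D.p i by omega), if_pos (by omega)]
      simp [this]
    · refine Finset.prod_congr rfl fun j hj => ?_
      rw [Finset.mem_erase] at hj
      simp [Ne.symm hj.1]
  · rw [if_neg h, if_neg fun h' => h (h0.1 h'), mul_zero]

end GLData

/-! ### Membership in the ideals `J P a` and their colon ideals -/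

namespace GLData
variable {k : Type u} [Field k] {d n : ℕ} (D : GLData k d n)

/-- The ideal of `R` generated by the `Xᵢ` with `i ∈ P` and by an ideal of `k[T]`. -/
noncomputable def J (P : Set (Fin n)) (a : Ideal D.S) : Ideal D.R :=
  Ideal.span (D.xR '' P) ⊔ a.map D.iota

variable {D}

theorem xR_mem_J {P : Set (Fin n)} {a : Ideal D.S} {i : Fin n} (hi : i ∈ P) :
    D.xR i ∈ D.J P a :=
  Ideal.mem_sup_left (Ideal.subset_span ⟨i, hi, rfl⟩)

theorem iota_mem_J {P : Set (Fin n)} {a : Ideal D.S} {f : D.S} (hf : f ∈ a) :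
    D.iota f ∈ D.J P a :=
  Ideal.mem_sup_right (Ideal.mem_map_of_mem _ hf)

/-- A multiple of `Xᵢ` has a coefficient with `bᵢ = 0` only through wrap-around, and that
coefficient is divisible by `ℓᵢ ∈ a`. Thus `R / J P a` is free over `k[T] / a` on the reduced
monomials without variables in `P`. -/
theorem coef_mem_of_mem_J {P : Set (Fin n)} {a : Ideal D.S} (h : ∀ i ∈ P, D.ell i ∈ a)
    {r : D.R} (hr : r ∈ D.J P a) {b : Fin n → ℕ} (hb : ∀ i ∈ P, b i = 0) :
    D.coef b r ∈ a := by
  suffices hs : ∀ s, D.coef b (s * r) ∈ a by simpa using hs 1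
  rw [J, Ideal.map, ← Ideal.span_union] at hr
  induction hr using Submodule.span_induction with
  | zero => simp
  | add x y hx hy h h' => intro s; rw [mul_add, map_add]; exact add_mem (h s) (h' s)
  | smul t x hx h => intro s; rw [smul_eq_mul, ← mul_assoc]; exact h _
  | mem x hx =>
    intro s
    rcases hx with ⟨i, hi, rfl⟩ | ⟨f, hf, rfl⟩
    · have hp := D.two_le_p i
      -- The exponent `pᵢ - 1` is the one that wraps around to `0 = b i`.
      have := D.coef_xR_mul_of_last (b := Function.update b i (D.p i - 1)) (i := i)
        (by rw [Function.update_self]; omega) s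
      rw [Function.update_idem, ← hb i hi, Function.update_eq_self] at this
      rw [mul_comm, this]
      exact Ideal.mul_mem_right _ _ (h i hi)
    · rw [mul_comm, coef_iota_mul]
      exact Ideal.mul_mem_right _ _ hf

theorem mem_of_coef {K : Ideal D.R} {r : D.R}
    (h : ∀ b : Fin n → ℕ, (∀ i, b i < D.p i) → D.iota (D.coef b r) * D.mon b ∈ K) : r ∈ K := by
  rw [D.eq_sum_coef r]
  exact Ideal.sum_mem _ fun b hb => h b (D.mem_reduced.1 hb)

theorem mon_mem {K : Ideal D.R} {b : Fin n → ℕ} {i : Fin n} {e : ℕ} (h : D.xR i ^ e ∈ K)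
    (hb : e ≤ b i) : D.mon b ∈ K :=
  K.mem_of_dvd ((pow_dvd_pow _ hb).trans (Finset.dvd_prod_of_mem _ (Finset.mem_univ i))) h

/-- To check membership in an ideal containing `J P a`, only the coefficients of the monomials
without the variables in `P` matter. -/
theorem mem_of_coef_of_J_le {P : Set (Fin n)} {a : Ideal D.S} {K : Ideal D.R} (hK : D.J P a ≤ K)
    {r : D.R}
    (h : ∀ b : Fin n → ℕ, (∀ i, b i < D.p i) → (∀ i ∈ P, b i = 0) →
      D.coef b r ∈ a ∨ D.mon b ∈ K) : r ∈ K := by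
  refine mem_of_coef fun b hb => ?_
  by_cases hP : ∀ i ∈ P, b i = 0
  · rcases h b hb hP with h | h
    · exact Ideal.mul_mem_right _ _ (hK (iota_mem_J h))
    · exact Ideal.mul_mem_left _ _ h
  · push Not at hP
    obtain ⟨i, hi, hbi⟩ := hP
    refine Ideal.mul_mem_left _ _ (mon_mem (i := i) (e := 1) ?_ (by omega))
    rw [pow_one]
    exact hK (xR_mem_J hi)

/-- On the basis of reduced monomials `Xᵢ` acts by a cyclic permutation up to the factor `ℓᵢ`, so it
inherits regularity from `ℓᵢ` modulo `a`. -/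
theorem mem_J_of_xR_mul_mem {P : Set (Fin n)} {a : Ideal D.S} (h : ∀ i ∈ P, D.ell i ∈ a)
    {i : Fin n} (hi : i ∉ P) (hreg : ∀ f, D.ell i * f ∈ a → f ∈ a) {r : D.R}
    (hr : D.xR i * r ∈ D.J P a) : r ∈ D.J P a := by
  refine mem_of_coef_of_J_le le_rfl fun b hb hP => Or.inl ?_
  have hne : ∀ e, ∀ j ∈ P, Function.update b i e j = 0 := fun e j hj => by
    rw [Function.update_of_ne (ne_of_mem_of_not_mem hj hi)]
    exact hP j hj
  by_cases hbi : b i + 1 = D.p i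
  · exact hreg _ (D.coef_xR_mul_of_last hbi r ▸ coef_mem_of_mem_J h hr (hne _))
  · exact D.coef_xR_mul (lt_of_le_of_ne (hb i) hbi) r ▸ coef_mem_of_mem_J h hr (hne _)

/-- Without regularity of `ℓᵢ`, the only basis monomials that `Xᵢ` can kill are those with the top
exponent `bᵢ = pᵢ - 1`. -/
theorem mem_J_sup_of_xR_mul_mem {P : Set (Fin n)} {a : Ideal D.S} (h : ∀ i ∈ P, D.ell i ∈ a)
    {i : Fin n} (hi : i ∉ P) {r : D.R} (hr : D.xR i * r ∈ D.J P a) :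
    r ∈ D.J P a ⊔ Ideal.span {D.xR i ^ (D.p i - 1)} := by
  refine mem_of_coef_of_J_le le_sup_left fun b hb hP => ?_
  by_cases hbi : b i + 1 = D.p i
  · exact Or.inr (mon_mem (i := i) (Ideal.mem_sup_right (Ideal.mem_span_singleton_self _))
      (by omega))
  · refine Or.inl (D.coef_xR_mul (lt_of_le_of_ne (hb i) hbi) r ▸ coef_mem_of_mem_J h hr
      fun j hj => ?_)
    rw [Function.update_of_ne (ne_of_mem_of_not_mem hj hi)]
    exact hP j hj

theorem coef_xR_pow_mul {b : Fin n → ℕ} {i : Fin n} (hb : b i = 0) (r : D.R) (e : ℕ)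
    (he : e < D.p i) : D.coef (Function.update b i e) (D.xR i ^ e * r) = D.coef b r := by
  induction e with
  | zero => rw [← hb, Function.update_eq_self, hb, pow_zero, one_mul]
  | succ e ih =>
    have := D.coef_xR_mul (b := Function.update b i e) (i := i)
      (by rw [Function.update_self]; exact he) (D.xR i ^ e * r)
    rw [Function.update_idem, Function.update_self] at this
    rw [pow_succ', mul_assoc, this, ih (by omega)]

/-- The power `Xᵢ ^ (pᵢ - 1)` moves the monomials with `bᵢ = 0` without wrap-around; all others are
already multiples of `Xᵢ`. -/
theorem mem_J_sup_of_xR_pow_mul_mem {P : Set (Fin n)} {a : Ideal D.S}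
    (h : ∀ i ∈ P, D.ell i ∈ a) {i : Fin n} (hi : i ∉ P) {r : D.R}
    (hr : D.xR i ^ (D.p i - 1) * r ∈ D.J P a) : r ∈ D.J P a ⊔ Ideal.span {D.xR i} := by
  refine mem_of_coef_of_J_le le_sup_left fun b hb hP => ?_
  by_cases hbi : b i = 0
  · refine Or.inl (coef_xR_pow_mul hbi r (D.p i - 1) (by have := D.p_pos i; omega) ▸
      coef_mem_of_mem_J h hr fun j hj => ?_)
    rw [Function.update_of_ne (ne_of_mem_of_not_mem hj hi)]
    exact hP j hj
  · refine Or.inr (mon_mem (i := i) (e := 1) ?_ (by omega))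
    rw [pow_one]
    exact Ideal.mem_sup_right (Ideal.mem_span_singleton_self _)

theorem mem_J_of_iota_mul_mem {P : Set (Fin n)} {a : Ideal D.S} (h : ∀ i ∈ P, D.ell i ∈ a)
    {g : D.S} (hreg : ∀ f, g * f ∈ a → f ∈ a) {r : D.R}
    (hr : D.iota g * r ∈ D.J P a) : r ∈ D.J P a :=
  mem_of_coef_of_J_le le_rfl fun b _ hP =>
    Or.inl (hreg _ (D.coef_iota_mul b g r ▸ coef_mem_of_mem_J h hr hP))

end GLData

/-! ### Linear forms -/

section LinearForms

open MvPolynomial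

variable {k : Type u} [Field k] {σ : Type*}

/-- The kernels of the powers of `φ` stabilise at some `N`. An element of `ker φ` has the form `φ^N
y`, so `y ∈ ker φ^(N+1) = ker φ^N` and the element is zero. -/
theorem RingHom.injective_of_surjective_of_isNoetherianRing {B : Type*} [CommRing B]
    [IsNoetherianRing B] (φ : B →+* B) (h : Function.Surjective φ) : Function.Injective φ := by
  obtain ⟨N, hN⟩ := monotone_stabilizes_iff_noetherian.2 (inferInstanceAs (IsNoetherian B B))
    ⟨fun m => RingHom.ker (φ ^ m), monotone_nat_of_le_succ fun m x hx => by
      rw [RingHom.mem_ker] at hx ⊢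
      rw [pow_succ', RingHom.mul_def, RingHom.comp_apply, hx, map_zero]⟩
  rw [injective_iff_map_eq_zero]
  intro x hx
  obtain ⟨y, rfl⟩ : ∃ y, (φ ^ N) y = x := by
    rw [RingHom.coe_pow]
    exact h.iterate N x
  have hy : y ∈ RingHom.ker (φ ^ (N + 1)) := by
    rw [RingHom.mem_ker, pow_succ', RingHom.mul_def, RingHom.comp_apply, hx]
  have hN' : RingHom.ker (φ ^ N) = RingHom.ker (φ ^ (N + 1)) := hN (N + 1) (Nat.le_succ N)
  rw [← hN'] at hy
  exact RingHom.mem_ker.1 hy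

theorem mem_span_X_of_X_mul_mem {P : Set σ} {i : σ} (hi : i ∉ P) {f : MvPolynomial σ k}
    (hf : X i * f ∈ Ideal.span (X '' P : Set (MvPolynomial σ k))) :
    f ∈ Ideal.span (X '' P : Set (MvPolynomial σ k)) := by
  classical
  rw [mem_ideal_span_X_image] at hf ⊢
  intro m hm
  obtain ⟨j, hj, hj'⟩ := hf (Finsupp.single i 1 + m) (by
    rw [mem_support_iff, coeff_X_mul]
    exact mem_support_iff.1 hm)
  refine ⟨j, hj, ?_⟩
  rw [Finsupp.add_apply, Finsupp.single_apply, if_neg (ne_of_mem_of_not_mem hj hi).symm] at hj'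
  simpa using hj'

/-- A basis of the space of linear forms is a regular sequence in any order. -/
theorem mem_span_of_basis_mul_mem [Finite σ] {t : σ → MvPolynomial σ k}
    (hspan : ∀ j, X j ∈ Submodule.span k (Set.range t))
    {P : Set σ} {i : σ} (hi : i ∉ P) {f : MvPolynomial σ k} (hf : t i * f ∈ Ideal.span (t '' P)) :
    f ∈ Ideal.span (t '' P) := by
  -- The substitution `X j ↦ t j` is an automorphism, which reduces the claim to ideals generated by
  -- variables.
  let φ : MvPolynomial σ k →ₐ[k] MvPolynomial σ k := aeval t
  have hφX : ∀ i, φ (X i) = t i := fun i => aeval_X _ _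
  have hsurj : Function.Surjective φ := by
    rw [← AlgHom.range_eq_top, eq_top_iff, ← MvPolynomial.adjoin_range_X, Algebra.adjoin_le_iff]
    rintro _ ⟨j, rfl⟩
    have hle : Submodule.span k (Set.range t) ≤ Subalgebra.toSubmodule φ.range := by
      rw [Submodule.span_le]
      rintro _ ⟨l, rfl⟩
      exact ⟨X l, hφX l⟩
    exact hle (hspan j)
  have hinj : Function.Injective φ :=
    RingHom.injective_of_surjective_of_isNoetherianRing (φ : MvPolynomial σ k →+* _) hsurj
  have hmap : Ideal.span (t '' P) = (Ideal.span (X '' P)).map φ := by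
    rw [Ideal.map_span, ← Set.image_comp]
    congr 2
    funext j
    exact (hφX j).symm
  obtain ⟨g, rfl⟩ := hsurj f
  have hcm : ∀ g, φ g ∈ Ideal.span (t '' P) ↔ g ∈ Ideal.span (X '' P) := by
    intro g
    rw [hmap, Ideal.mem_map_iff_of_surjective _ hsurj]
    exact ⟨fun ⟨x, hx, hxg⟩ => hinj hxg ▸ hx, fun h => ⟨g, h, rfl⟩⟩
  rw [← hφX, ← map_mul, hcm] at hf
  exact (hcm g).2 (mem_span_X_of_X_mul_mem hi hf)

end LinearForms

namespace GLData
variable {k : Type u} [Field k] {d n : ℕ} (D : GLData k d n)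

/-! ### Homogeneous ideals of `R` -/

noncomputable instance :
    GradedAlgebra (MvPolynomial.weightedHomogeneousSubmodule k D.weight) :=
  MvPolynomial.weightedGradedAlgebra k D.weight

theorem rename_mem_of_isHomogeneous {f : D.S} (hf : f.IsHomogeneous 1) :
    MvPolynomial.rename Sum.inl f ∈ MvPolynomial.weightedHomogeneousSubmodule k D.weight D.c := by
  have hf' : f ∈ MvPolynomial.homogeneousSubmodule (Fin (d + 1)) k 1 := hf
  rw [MvPolynomial.homogeneousSubmodule_one_eq_span_X] at hf'
  induction hf' using Submodule.span_induction with
  | zero => rw [map_zero]; exact Submodule.zero_mem _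
  | add x y _ _ h h' =>
    rw [map_add]
    exact Submodule.add_mem _ (h (by rwa [← MvPolynomial.mem_homogeneousSubmodule,
      MvPolynomial.homogeneousSubmodule_one_eq_span_X])) (h' (by
      rwa [← MvPolynomial.mem_homogeneousSubmodule,
      MvPolynomial.homogeneousSubmodule_one_eq_span_X]))
  | smul a x _ h =>
    rw [map_smul]
    exact Submodule.smul_mem _ _ (h (by rwa [← MvPolynomial.mem_homogeneousSubmodule,
      MvPolynomial.homogeneousSubmodule_one_eq_span_X]))
  | mem x hx =>
    obtain ⟨j, rfl⟩ := hx
    rw [MvPolynomial.rename_X]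
    exact MvPolynomial.isWeightedHomogeneous_X k D.weight (Sum.inl j)

theorem iota_mem_component {f : D.S} (hf : f.IsHomogeneous 1) : D.iota f ∈ D.component D.c :=
  ⟨_, D.rename_mem_of_isHomogeneous hf, rfl⟩

theorem xR_mem_component (i : Fin n) : D.xR i ∈ D.component (D.x i) :=
  ⟨_, MvPolynomial.isWeightedHomogeneous_X k D.weight (Sum.inr i), rfl⟩

theorem xR_pow_mem_component (i : Fin n) (e : ℕ) : D.xR i ^ e ∈ D.component (e • D.x i) :=
  ⟨_, (MvPolynomial.isWeightedHomogeneous_X k D.weight (Sum.inr i)).pow e, rfl⟩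

theorem relIdeal_isHomogeneous :
    D.relIdeal.IsHomogeneous (MvPolynomial.weightedHomogeneousSubmodule k D.weight) := by
  refine Ideal.homogeneous_span _ _ ?_
  rintro _ ⟨i, rfl⟩
  refine ⟨D.c, ?_⟩
  refine Submodule.sub_mem _ ?_ (D.rename_mem_of_isHomogeneous (D.ell_linear i))
  have := (MvPolynomial.isWeightedHomogeneous_X k D.weight (Sum.inr i)).pow (D.p i)
  rwa [show D.weight (Sum.inr i) = D.x i from rfl, p_smul_x] at this

/-- The projection of `R` onto its homogeneous component of degree `z`. -/
noncomputable def proj (z : D.L) : D.R →+ D.R :=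
  QuotientAddGroup.map (Submodule.toAddSubgroup D.relIdeal) (Submodule.toAddSubgroup D.relIdeal)
    (MvPolynomial.weightedHomogeneousComponent D.weight z).toAddMonoidHom
    fun _ hq => MvPolynomial.weightedHomogeneousComponent_mem_of_mem k D.weight
      D.relIdeal_isHomogeneous hq z

theorem proj_mk (z : D.L) (q : D.Poly) : D.proj z (Ideal.Quotient.mk D.relIdeal q) =
    Ideal.Quotient.mk D.relIdeal (MvPolynomial.weightedHomogeneousComponent D.weight z q) := rfl

theorem proj_mem (z : D.L) (r : D.R) : D.proj z r ∈ D.component z := by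
  obtain ⟨q, rfl⟩ := Ideal.Quotient.mk_surjective r
  exact ⟨_, MvPolynomial.weightedHomogeneousComponent_mem D.weight q z, rfl⟩

theorem proj_of_mem {z : D.L} {r : D.R} (hr : r ∈ D.component z) : D.proj z r = r := by
  obtain ⟨q, hq, rfl⟩ := hr
  change D.proj z (Ideal.Quotient.mk D.relIdeal q) = Ideal.Quotient.mk D.relIdeal q
  rw [proj_mk, MvPolynomial.weightedHomogeneousComponent_eq_self hq]

theorem coe_decompose_eq (z : D.L) (q : D.Poly) :
    (DirectSum.decompose (MvPolynomial.weightedHomogeneousSubmodule k D.weight) q z : D.Poly) =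
      MvPolynomial.weightedHomogeneousComponent D.weight z q :=
  MvPolynomial.decompose'_apply k D.weight q z

theorem proj_mul {z y : D.L} {g : D.R} (hg : g ∈ D.component y) (r : D.R) :
    D.proj z (r * g) = D.proj (z - y) r * g := by
  obtain ⟨q, rfl⟩ := Ideal.Quotient.mk_surjective r
  obtain ⟨f, hf, rfl⟩ := hg
  change D.proj z (Ideal.Quotient.mk D.relIdeal q * Ideal.Quotient.mk D.relIdeal f) =
    D.proj (z - y) (Ideal.Quotient.mk D.relIdeal q) * Ideal.Quotient.mk D.relIdeal f
  rw [← map_mul, proj_mk, proj_mk, ← map_mul, ← coe_decompose_eq, ← coe_decompose_eq,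
    ← DirectSum.coe_decompose_mul_add_of_right_mem _ hf, sub_add_cancel]

/-- An ideal of `R` is homogeneous if it contains the homogeneous components of its elements. -/
def IsHomog (K : Ideal D.R) : Prop := ∀ r ∈ K, ∀ z, D.proj z r ∈ K

variable {D}

theorem isHomog_span {s : Set D.R} (hs : ∀ g ∈ s, ∃ y, g ∈ D.component y) :
    D.IsHomog (Ideal.span s) := by
  intro r hr
  suffices h : ∀ t z, D.proj z (t * r) ∈ Ideal.span s by simpa using h 1
  induction hr using Submodule.span_induction with
  | zero => simp
  | add x y _ _ h h' => intro t z; rw [mul_add, map_add]; exact add_mem (h t z) (h' t z)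
  | smul a x _ h => intro t z; rw [smul_eq_mul, ← mul_assoc]; exact h _ z
  | mem x hx =>
    intro t z
    obtain ⟨y, hy⟩ := hs x hx
    rw [D.proj_mul hy]
    exact Ideal.mul_mem_left _ _ (Ideal.subset_span hx)

/-- Projecting a relation `r = s + v * g` to degree `z` replaces `v` by its component of degree `z -
y`. Exactness can then be checked degree by degree. -/
theorem exists_sub_mul_mem {K : Ideal D.R} (hK : D.IsHomog K) {g r : D.R} {y z : D.L}
    (hg : g ∈ D.component y) (hr : r ∈ D.component z) (h : r ∈ K ⊔ Ideal.span {g}) :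
    ∃ t ∈ D.component (z - y), r - g * t ∈ K := by
  obtain ⟨s, hs, u, hu, hsu⟩ := Submodule.mem_sup.1 h
  obtain ⟨v, rfl⟩ := Ideal.mem_span_singleton'.1 hu
  refine ⟨D.proj (z - y) v, D.proj_mem _ _, ?_⟩
  have h1 := D.proj_of_mem hr
  rw [← hsu, map_add, D.proj_mul hg, hsu] at h1
  rw [← h1, mul_comm g, add_sub_cancel_right]
  exact hK s hs z

/-! ### The support of `R` -/

theorem exists_monomial_of_mem_component {y : D.L} {r : D.R} (hr : r ∈ D.component y) :
    ∃ q : D.Poly, Ideal.Quotient.mk D.relIdeal q = r ∧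
      ∀ m ∈ q.support, m.sum (fun i e => e • D.weight i) = y := by
  obtain ⟨q, hq, rfl⟩ := hr
  refine ⟨q, rfl, fun m hm => ?_⟩
  have := hq (MvPolynomial.mem_support_iff.1 hm)
  rwa [Finsupp.weight_apply] at this

theorem weight_mem_Lpos (i : Fin (d + 1) ⊕ Fin n) : D.weight i ∈ D.Lpos := by
  refine AddSubmonoid.subset_closure ?_
  rcases i with i | i
  · exact Set.mem_insert _ _
  · exact Set.mem_insert_of_mem _ ⟨i, rfl⟩

theorem eq_zero_of_notMem_Lpos {y : D.L} (hy : y ∉ D.Lpos) {r : D.R} (hr : r ∈ D.component y) :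
    r = 0 := by
  obtain ⟨q, rfl, hq⟩ := exists_monomial_of_mem_component hr
  by_cases h : q = 0
  · rw [h, map_zero]
  · obtain ⟨m, hm⟩ := MvPolynomial.support_nonempty.2 h
    refine absurd ?_ hy
    rw [← hq m hm]
    exact AddSubmonoid.sum_mem _ fun i _ => AddSubmonoid.nsmul_mem _ (weight_mem_Lpos i) _

theorem degZ_weight_pos (i : Fin (d + 1) ⊕ Fin n) : 0 < D.degZ (D.weight i) := by
  rcases i with i | i
  · exact D.degZ_c_pos
  · exact D.degZ_x_pos i

/-- All variables have positive `degZ`, so only the constant monomial has degree `0`. -/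
theorem exists_algebraMap_of_mem_component_zero {r : D.R} (hr : r ∈ D.component 0) :
    ∃ a : k, r = algebraMap k D.R a := by
  obtain ⟨q, rfl, hq⟩ := exists_monomial_of_mem_component hr
  refine ⟨q.coeff 0, ?_⟩
  have : q = MvPolynomial.C (q.coeff 0) := by
    ext m
    rw [MvPolynomial.coeff_C]
    split_ifs with h
    · rw [h]
    · by_contra hm
      have h0 := congrArg D.degZ (hq m (MvPolynomial.mem_support_iff.2 hm))
      rw [Finsupp.sum, map_sum, map_zero] at h0
      rw [Finset.sum_eq_zero_iff_of_nonneg] at h0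
      · refine h (Finsupp.ext fun i => ?_)
        by_contra hi
        have := h0 i (Finsupp.mem_support_iff.2 (Ne.symm hi))
        rw [map_nsmul, nsmul_eq_mul, mul_eq_zero] at this
        rcases this with h1 | h1
        · exact hi (by rw [Finsupp.zero_apply]; exact_mod_cast h1.symm)
        · exact (degZ_weight_pos i).ne' h1
      · intro i _
        rw [map_nsmul, nsmul_eq_mul]
        exact mul_nonneg (Int.natCast_nonneg _) (degZ_weight_pos i).le
  conv_lhs => rw [this]
  rfl

/-- An ideal of `R` which is maximal among the proper homogeneous ideals. -/
structure IsAugmentation (K : Ideal D.R) : Prop where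
  xR_mem : ∀ i, D.xR i ∈ K
  iota_mem : ∀ j, D.iota (MvPolynomial.X j) ∈ K
  one_notMem : 1 ∉ K

theorem IsAugmentation.mem_of_mem_component {K : Ideal D.R} (hK : IsAugmentation K) {y : D.L}
    (hy : y ≠ 0) {r : D.R} (hr : r ∈ D.component y) : r ∈ K := by
  obtain ⟨q, rfl, hq⟩ := exists_monomial_of_mem_component hr
  rw [MvPolynomial.as_sum q, map_sum]
  refine Ideal.sum_mem _ fun m hm => ?_
  have hm0 : m ≠ 0 := by
    rintro rfl
    exact hy (by simpa using (hq 0 hm).symm)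
  obtain ⟨i, hi⟩ := Finsupp.ne_iff.1 hm0
  have hX : Ideal.Quotient.mk D.relIdeal (MvPolynomial.X i) ∈ K := by
    rcases i with i | i
    · have := hK.iota_mem i
      simpa [iota] using this
    · exact hK.xR_mem i
  refine K.mem_of_dvd (map_dvd _ ?_) hX
  rw [MvPolynomial.X_dvd_monomial]
  exact Or.inr hi

theorem IsAugmentation.eq_zero {K : Ideal D.R} (hK : IsAugmentation K) {a : k}
    (ha : algebraMap k D.R a ∈ K) : a = 0 := by
  by_contra h
  refine hK.one_notMem ?_
  have := K.mul_mem_left (algebraMap k D.R a⁻¹) ha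
  rwa [← map_mul, inv_mul_cancel₀ h, map_one] at this

variable (D) in
/-- The augmentation `R → k`. -/
noncomputable def aug : D.R →+* k :=
  Ideal.Quotient.lift D.relIdeal MvPolynomial.constantCoeff (by
    suffices h : D.relIdeal ≤ RingHom.ker (MvPolynomial.constantCoeff : D.Poly →+* k) from
      fun a ha => h ha
    rw [relIdeal, Ideal.span_le]
    rintro _ ⟨i, rfl⟩
    have h0 : MvPolynomial.constantCoeff (D.ell i) = 0 := by
      rw [MvPolynomial.constantCoeff_eq]
      exact (D.ell_linear i).coeff_eq_zero (by simp)
    simp [RingHom.mem_ker, MvPolynomial.constantCoeff_rename, h0, (D.p_pos i).ne'])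

theorem aug_xR (i : Fin n) : D.aug (D.xR i) = 0 :=
  (Ideal.Quotient.lift_mk _ _ _).trans (MvPolynomial.constantCoeff_X _ _)

theorem aug_iota {f : D.S} (hf : f.IsHomogeneous 1) : D.aug (D.iota f) = 0 := by
  refine (Ideal.Quotient.lift_mk _ _ _).trans ?_
  change MvPolynomial.constantCoeff (MvPolynomial.rename Sum.inl f) = 0
  rw [MvPolynomial.constantCoeff_rename, MvPolynomial.constantCoeff_eq]
  exact hf.coeff_eq_zero (by simp)

/-! ### Completing the linear forms -/

/-- The `ℓᵢ` are prolonged to a sequence whose first `d + 1` terms are a basis of the linear forms.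
This is automatic for `n ≥ d + 1`; otherwise independent forms are appended one at a time. -/
theorem exists_linearForms (D : GLData k d n) : ∃ t : ℕ → D.S, (∀ i : Fin n, t i = D.ell i) ∧
    (∀ i, (t i).IsHomogeneous 1) ∧
    ∀ j, MvPolynomial.X j ∈ Submodule.span k (Set.range fun i : Fin (d + 1) => t i) := by
  let V := MvPolynomial.homogeneousSubmodule (Fin (d + 1)) k 1
  have hV : V = Submodule.span k (Set.range MvPolynomial.X) :=
    MvPolynomial.homogeneousSubmodule_one_eq_span_X
  have hfin : Module.finrank k V = d + 1 := by
    rw [hV, finrank_span_eq_card (MvPolynomial.linearIndependent_X _ _), Fintype.card_fin]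
  have hFD : FiniteDimensional k V := Module.finite_of_finrank_pos (by omega)
  suffices h : ∃ t : ℕ → V, (∀ i : Fin n, (t i : D.S) = D.ell i) ∧
      LinearIndependent k fun i : Fin (d + 1) => t i by
    obtain ⟨t, ht, hli⟩ := h
    refine ⟨fun i => t i, ht, fun i => (t i).2, fun j => ?_⟩
    have hspan := hli.span_eq_top_of_card_eq_finrank' (by rw [hfin, Fintype.card_fin])
    have hX : MvPolynomial.X j ∈ V := MvPolynomial.isHomogeneous_X k j
    have : (⟨MvPolynomial.X j, hX⟩ : V) ∈ Submodule.span k (Set.range fun i : Fin (d + 1) => t i) :=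
      hspan ▸ Submodule.mem_top
    have := Submodule.mem_map_of_mem (f := V.subtype) this
    rw [Submodule.map_span, ← Set.range_comp] at this
    exact this
  let l : Fin n → V := fun i => ⟨D.ell i, D.ell_linear i⟩
  -- General position is only needed for initial segments, because the generators are adjoined in a
  -- fixed order.
  have hl : ∀ m (hm : m ≤ n) (_ : m ≤ d + 1), LinearIndependent k fun i : Fin m => l (i.castLE hm) := by
    intro m hm hmd
    refine LinearIndependent.of_comp V.subtype ?_
    let s : Finset (Fin n) := Finset.univ.map (Fin.castLEEmb hm)
    have := D.general_position s (by simpa [s] using hmd)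
    exact this.comp (fun i : Fin m => (⟨i.castLE hm, by simp [s]⟩ : s)) fun i j hij => by
      simpa using hij
  by_cases hn : d + 1 ≤ n
  -- The filler value `0` is harmless: it is homogeneous of degree one, and indices from `n` on lie
  -- beyond the basis.
  · refine ⟨fun i => if h : i < n then l ⟨i, h⟩ else 0, fun i => by simp [l], ?_⟩
    convert hl (d + 1) hn le_rfl using 2 with i
    exact dif_pos (by omega)
  · have key : ∀ m, n ≤ m → m ≤ d + 1 → ∃ t : ℕ → V, (∀ i : Fin n, (t i : D.S) = D.ell i) ∧
        LinearIndependent k fun i : Fin m => t i := by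
      intro m hm
      induction m, hm using Nat.le_induction with
      | base =>
        intro hm
        refine ⟨fun i => if h : i < n then l ⟨i, h⟩ else 0, fun i => by simp [l], ?_⟩
        convert hl n le_rfl hm using 2 with i
        exact dif_pos i.2
      | succ m hnm ih =>
        intro hm
        obtain ⟨t, ht, hli⟩ := ih (by omega)
        obtain ⟨x, hx⟩ := exists_linearIndependent_snoc_of_lt_finrank hli (by omega)
        refine ⟨Function.update t m x, fun i => ?_, ?_⟩
        · rw [Function.update_of_ne (by omega), ht]
        · have : (fun i : Fin (m + 1) => Function.update t m x i) =
              Fin.snoc (fun i : Fin m => t i) x := by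
            funext i
            refine Fin.lastCases ?_ (fun i => ?_) i
            · simp
            · simp [Function.update_of_ne i.2.ne]
          rw [this]
          exact hx
    exact key (d + 1) (by omega) le_rfl

end GLData

open MulOpposite

namespace GLData
variable {k : Type u} [Field k] {d n : ℕ} (D : GLData k d n) (I : Finset D.L)

/-! ### Row modules -/

/-- The opposite algebra of the canonical algebra `A^I`; its modules are the right `A^I`-modules. -/
def OpAlg : Type u := (D.canonicalAlgebra I)ᵐᵒᵖ

noncomputable instance : Ring (D.OpAlg I) := inferInstanceAs (Ring (D.canonicalAlgebra I)ᵐᵒᵖ)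

variable {D I}

/-- The matrix of an element of the opposite algebra of `A^I`. -/
def OpAlg.mat (a : D.OpAlg I) : Matrix I I D.R := (unop a).1

theorem OpAlg.mat_mem (a : D.OpAlg I) (y z : I) : a.mat y z ∈ D.component (y - z) := (unop a).2 y z

/-- The element of the opposite algebra of `A^I` with a given matrix. -/
def OpAlg.mk (M : Matrix I I D.R) (h : ∀ y z : I, M y z ∈ D.component (y - z)) : D.OpAlg I :=
  op ⟨M, h⟩

@[simp] theorem OpAlg.mat_mk (M : Matrix I I D.R)
    (h : ∀ y z : I, M y z ∈ D.component (y - z)) : (OpAlg.mk M h).mat = M := rfl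

@[ext] theorem OpAlg.ext {a b : D.OpAlg I} (h : a.mat = b.mat) : a = b :=
  unop_injective (Subtype.ext h)

@[simp] theorem OpAlg.mat_add (a b : D.OpAlg I) : (a + b).mat = a.mat + b.mat := rfl

@[simp] theorem OpAlg.mat_mul (a b : D.OpAlg I) : (a * b).mat = b.mat * a.mat := rfl

@[simp] theorem OpAlg.mat_one : (1 : D.OpAlg I).mat = 1 := rfl

@[simp] theorem OpAlg.mat_zero : (0 : D.OpAlg I).mat = 0 := rfl

theorem OpAlg.mat_sum {ι : Type*} (s : Finset ι) (f : ι → D.OpAlg I) :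
    (∑ i ∈ s, f i).mat = ∑ i ∈ s, (f i).mat := by
  classical
  induction s using Finset.induction_on with
  | empty => rfl
  | insert i s hi ih => rw [Finset.sum_insert hi, Finset.sum_insert hi, mat_add, ih]

variable (D I)

/-- Row vectors with entries in `R`, as a right module over `A^I`. -/
def Row : Type u := I → D.R

noncomputable instance : AddCommGroup (D.Row I) := inferInstanceAs (AddCommGroup (I → D.R))

noncomputable instance : Module (D.OpAlg I) (D.Row I) where
  smul a v := Matrix.vecMul (v : I → D.R) a.mat
  one_smul v := Matrix.vecMul_one (v : I → D.R)
  mul_smul _ _ v := (Matrix.vecMul_vecMul (v : I → D.R) _ _).symm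
  smul_zero _ := Matrix.zero_vecMul _
  smul_add _ v w := Matrix.add_vecMul _ (v : I → D.R) (w : I → D.R)
  add_smul _ _ v := Matrix.vecMul_add _ _ (v : I → D.R)
  zero_smul v := Matrix.vecMul_zero (v : I → D.R)

variable {D I}

theorem Row.smul_apply (a : (D.OpAlg I)) (v : D.Row I) (z : I) :
    (a • v) z = ∑ y, v y * a.mat y z := rfl

@[ext] theorem Row.ext {v w : D.Row I} (h : ∀ z, v z = w z) : v = w := funext h

variable (I) in
/-- The row vectors with entries in the components of an ideal `K`, placed in row `w`. -/
def row (K : Ideal D.R) (w : D.L) : Submodule (D.OpAlg I) (D.Row I) where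
  carrier := {v | ∀ z : I, v z ∈ K ∧ v z ∈ D.component (w - z)}
  add_mem' hv hw z := ⟨add_mem (hv z).1 (hw z).1, add_mem (hv z).2 (hw z).2⟩
  zero_mem' _ := ⟨zero_mem _, zero_mem _⟩
  smul_mem' a v hv z := by
    rw [Row.smul_apply]
    refine ⟨Ideal.sum_mem _ fun y _ => K.mul_mem_right _ (hv y).1,
      Submodule.sum_mem _ fun y _ => ?_⟩
    have := D.mul_mem_component (hv y).2 (a.mat_mem y z)
    rwa [sub_add_sub_cancel] at this

theorem apply_mem_component {w : D.L} (v : row I (⊤ : Ideal D.R) w) (z : I) :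
    v.1 z ∈ D.component (w - z) := (v.2 z).2

variable (I) in
/-- The right `A^I`-module given by the graded cyclic `R`-module `(R / K)(w)`. -/
abbrev Cyc (K : Ideal D.R) (w : D.L) : Type u :=
  row I (⊤ : Ideal D.R) w ⧸ (row I K w).comap (row I (⊤ : Ideal D.R) w).subtype

theorem mk_eq_zero_iff {K : Ideal D.R} {w : D.L} (v : row I (⊤ : Ideal D.R) w) :
    (Submodule.Quotient.mk v : Cyc I K w) = 0 ↔ ∀ z, v.1 z ∈ K := by
  rw [Submodule.Quotient.mk_eq_zero, Submodule.mem_comap]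
  exact ⟨fun h z => (h z).1, fun h z => ⟨h z, apply_mem_component v z⟩⟩

variable (I) in
/-- Multiplication by a homogeneous element, on free row modules. -/
noncomputable def mulRow {g : D.R} {y : D.L} (hg : g ∈ D.component y) (w : D.L) :
    row I (⊤ : Ideal D.R) (w - y) →ₗ[(D.OpAlg I)] row I (⊤ : Ideal D.R) w where
  toFun v := ⟨fun z => g * v.1 z, fun z => ⟨trivial, by
    have := D.mul_mem_component hg (apply_mem_component v z)
    rwa [show y + (w - y - z) = w - z by abel] at this⟩⟩
  map_add' v v' := Subtype.ext (Row.ext fun z => mul_add _ _ _)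
  map_smul' a v := Subtype.ext (Row.ext fun z => by
    change g * (a • v.1) z = ∑ y, (g * v.1 y) * _
    rw [Row.smul_apply, Finset.mul_sum]
    exact Finset.sum_congr rfl fun y _ => (mul_assoc _ _ _).symm)

/-- The exact sequence `0 → (R / (K : g))(w - y) → (R / K)(w) → (R / (K + (g)))(w) → 0` for an
element `g` of degree `y`. -/
theorem exists_exact_cyc {K K' : Ideal D.R} (hK : D.IsHomog K) {g : D.R} {y : D.L}
    (hg : g ∈ D.component y) (hK' : ∀ r, g * r ∈ K ↔ r ∈ K') (w : D.L) :
    ∃ (f : Cyc I K' (w - y) →ₗ[(D.OpAlg I)] Cyc I K w)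
      (h : Cyc I K w →ₗ[(D.OpAlg I)] Cyc I (K ⊔ Ideal.span {g}) w),
      Function.Exact f h ∧ Function.Injective f ∧ Function.Surjective h := by
  have h1 : (row I K' (w - y)).comap (row I (⊤ : Ideal D.R) (w - y)).subtype ≤
      ((row I K w).comap (row I (⊤ : Ideal D.R) w).subtype).comap (mulRow I hg w) := by
    intro v hv z
    exact ⟨(hK' _).2 (hv z).1, apply_mem_component (mulRow I hg w v) z⟩
  have h2 : (row I K w).comap (row I (⊤ : Ideal D.R) w).subtype ≤
      (row I (K ⊔ Ideal.span {g}) w).comap (row I (⊤ : Ideal D.R) w).subtype :=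
    fun v hv z => ⟨Ideal.mem_sup_left (hv z).1, (hv z).2⟩
  refine ⟨Submodule.mapQ _ _ (mulRow I hg w) h1, Submodule.factor h2, ?_, ?_, ?_⟩
  · intro x
    obtain ⟨v, rfl⟩ := Submodule.Quotient.mk_surjective _ x
    change (Submodule.Quotient.mk v : Cyc I (K ⊔ Ideal.span {g}) w) = 0 ↔ _
    rw [mk_eq_zero_iff]
    constructor
    · intro hv
      choose t ht htK using fun z => exists_sub_mul_mem hK hg (apply_mem_component v z) (hv z)
      refine ⟨Submodule.Quotient.mk ⟨t, fun z => ⟨trivial, by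
        have := ht z
        rwa [show w - (z : D.L) - y = w - y - z by abel] at this⟩⟩, ?_⟩
      rw [Submodule.mapQ_apply, eq_comm, ← sub_eq_zero, ← Submodule.Quotient.mk_sub,
        mk_eq_zero_iff]
      exact htK
    · rintro ⟨x, hx⟩ z
      obtain ⟨t, rfl⟩ := Submodule.Quotient.mk_surjective _ x
      rw [Submodule.mapQ_apply, eq_comm, ← sub_eq_zero, ← Submodule.Quotient.mk_sub,
        mk_eq_zero_iff] at hx
      have h3 : v.1 z - g * t.1 z ∈ K := hx z
      have := add_mem (Ideal.mem_sup_left (T := Ideal.span {g}) h3)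
        (Ideal.mem_sup_right (S := K)
          (Ideal.mul_mem_right (t.1 z) _ (Ideal.mem_span_singleton_self g)))
      rwa [sub_add_cancel] at this
  · rw [injective_iff_map_eq_zero]
    intro x hx
    obtain ⟨v, rfl⟩ := Submodule.Quotient.mk_surjective _ x
    rw [Submodule.mapQ_apply, mk_eq_zero_iff] at hx
    rw [mk_eq_zero_iff]
    exact fun z => (hK' _).1 (hx z)
  · exact Submodule.factor_surjective h2

/-! ### Projectivity -/

/-- The matrix with a single row. -/
noncomputable def rowMatrix (w : I) :
    row I (⊤ : Ideal D.R) (w : D.L) →ₗ[D.OpAlg I] D.OpAlg I where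
  toFun v := OpAlg.mk (fun y z => if y = w then v.1 z else 0) fun y z => by
    split_ifs with h
    · rw [h]; exact apply_mem_component v z
    · exact zero_mem _
  map_add' v v' := by
    ext y z : 2
    change (if y = w then v.1 z + v'.1 z else 0) =
      (if y = w then v.1 z else 0) + (if y = w then v'.1 z else 0)
    split_ifs <;> simp
  map_smul' a v := by
    ext y z : 2
    change (if y = w then (a • v.1) z else 0) = ∑ x, (if y = w then v.1 x else 0) * a.mat x z
    split_ifs
    · rfl
    · simp

theorem one_mem_component : (1 : D.R) ∈ D.component 0 := by
  simpa using D.algebraMap_mem_component 1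

/-- The row of a matrix. -/
noncomputable def matrixRow (w : I) :
    D.OpAlg I →ₗ[D.OpAlg I] row I (⊤ : Ideal D.R) (w : D.L) where
  toFun a := ⟨fun z => a.mat w z, fun z => ⟨trivial, a.mat_mem w z⟩⟩
  map_add' _ _ := rfl
  map_smul' _ _ := rfl

theorem matrixRow_rowMatrix (w : I) (v : row I (⊤ : Ideal D.R) (w : D.L)) :
    matrixRow w (rowMatrix w v) = v :=
  Subtype.ext (Row.ext fun _ => if_pos rfl)

theorem row_projective (w : I) :
    Module.Projective (D.OpAlg I) (row I (⊤ : Ideal D.R) (w : D.L)) :=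
  Module.Projective.of_split (rowMatrix w) (matrixRow w)
    (LinearMap.ext fun v => matrixRow_rowMatrix w v)

/-- The module `(R / K)(w)` vanishes if no element of `I` is below `w`. -/
theorem subsingleton_cyc {K : Ideal D.R} {w : D.L} (h : ∀ z ∈ I, ¬ z ≤ w) :
    Subsingleton (Cyc I K w) := by
  refine subsingleton_of_forall_eq 0 fun x => ?_
  obtain ⟨v, rfl⟩ := Submodule.Quotient.mk_surjective _ x
  rw [mk_eq_zero_iff]
  intro z
  rw [eq_zero_of_notMem_Lpos (h z z.2) (apply_mem_component v z)]
  exact zero_mem _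

theorem cyc_bot_projective (w : I) :
    Module.Projective (D.OpAlg I) (Cyc I (⊥ : Ideal D.R) (w : D.L)) := by
  have := row_projective w
  refine Module.Projective.of_equiv (Submodule.quotEquivOfEqBot _ ?_).symm
  rw [eq_bot_iff]
  intro v hv
  exact Subtype.ext (Row.ext fun z => (hv z).1)

/-! ### Modules concentrated at a vertex -/

/-- The idempotent of `A^I` at a vertex. -/
noncomputable def idem (z : I) : D.OpAlg I :=
  OpAlg.mk (Matrix.single z z 1) fun x y => by
    rw [Matrix.single_apply]
    split_ifs with h
    · rw [← h.1, ← h.2, sub_self]; exact one_mem_component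
    · exact zero_mem _

theorem idem_mul_idem (z : I) : (idem z : D.OpAlg I) * idem z = idem z :=
  OpAlg.ext (by simp [idem])

theorem idem_mul_idem_of_ne {y z : I} (h : y ≠ z) : (idem y : D.OpAlg I) * idem z = 0 :=
  OpAlg.ext (by simp [idem, h.symm])

theorem sum_idem : ∑ z, (idem z : D.OpAlg I) = 1 := by
  ext x y : 2
  rw [OpAlg.mat_sum, Matrix.sum_apply]
  simp [idem, Matrix.single_apply, Matrix.one_apply, ite_and]

/-- The entry of `a` at `(x, y)` lies in `R_{x-y}`, which vanishes unless `y ≤ x`: the algebra is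
triangular for the order on `I`. -/
theorem idem_mul_mul_idem {x y : I} (a : D.OpAlg I) (h : ¬ (y : D.L) ≤ x) :
    idem y * a * idem x = 0 := by
  have h0 : a.mat x y = 0 := eq_zero_of_notMem_Lpos h (a.mat_mem x y)
  refine OpAlg.ext ?_
  simp only [OpAlg.mat_mul, idem, OpAlg.mat_mk, ← mul_assoc]
  rw [Matrix.single_mul_mul_single, h0]
  simp

/-- A right `A^I`-module `M` is concentrated at `z` if `M e_z = M`. -/
def ConcentratedAt (M : Type u) [AddCommGroup M] [Module (D.OpAlg I) M] (z : I) : Prop :=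
  ∀ m : M, (idem z : D.OpAlg I) • m = m

end GLData

namespace GLData
variable {k : Type u} [Field k] {d n : ℕ} {D : GLData k d n} {I : Finset D.L}

/-- The generator of the free row module. -/
noncomputable def unitRow (w : I) : row I (⊤ : Ideal D.R) (w : D.L) := matrixRow w 1

theorem unitRow_apply (w z : I) : (unitRow w).1 z = if w = z then (1 : D.R) else 0 := rfl

theorem rowMatrix_smul_unitRow (w : I) (v : row I (⊤ : Ideal D.R) (w : D.L)) :
    rowMatrix w v • unitRow w = v := by
  rw [unitRow, ← map_smul, smul_eq_mul, mul_one, matrixRow_rowMatrix]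

theorem idem_smul_unitRow (w : I) : (idem w : D.OpAlg I) • unitRow w = unitRow w := by
  rw [unitRow, ← map_smul, smul_eq_mul, mul_one]
  refine Subtype.ext (Row.ext fun z => ?_)
  change Matrix.single w w 1 w z = (1 : Matrix I I D.R) w z
  rw [Matrix.single_apply, Matrix.one_apply]
  simp

theorem idem_smul_apply (y : I) (v : D.Row I) (z : I) :
    ((idem y : D.OpAlg I) • v) z = if y = z then v z else 0 := by
  rw [Row.smul_apply]
  simp only [idem, OpAlg.mat_mk, Matrix.single_apply, ite_and, mul_ite, mul_one, mul_zero,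
    Finset.sum_ite_eq, Finset.mem_univ, if_true]
  split_ifs with h
  · rw [h]
  · rfl

theorem concentratedAt_cyc {K : Ideal D.R} (hK : IsAugmentation K) (w : I) :
    ConcentratedAt (Cyc I K (w : D.L)) w := by
  intro m
  obtain ⟨v, rfl⟩ := Submodule.Quotient.mk_surjective _ m
  rw [← Submodule.Quotient.mk_smul, ← sub_eq_zero, ← Submodule.Quotient.mk_sub, mk_eq_zero_iff]
  intro z
  change ((idem w : D.OpAlg I) • v.1) z - v.1 z ∈ K
  rw [idem_smul_apply]
  split_ifs with h
  · simp
  · rw [zero_sub]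
    exact neg_mem (hK.mem_of_mem_component
      (fun h0 => h (Subtype.ext (sub_eq_zero.1 h0))) (apply_mem_component v z))

/-- Homomorphisms from a projective module `e_w A` to a module concentrated elsewhere vanish. -/
theorem eq_zero_of_concentratedAt {K : Ideal D.R} {w v : I} (h : w ≠ v) {N : Type u}
    [AddCommGroup N] [Module (D.OpAlg I) N] (hN : ConcentratedAt N v)
    (f : Cyc I K (w : D.L) →ₗ[D.OpAlg I] N) : f = 0 := by
  have h0 : f (Submodule.Quotient.mk (unitRow w)) = 0 := by
    rw [← idem_smul_unitRow, Submodule.Quotient.mk_smul, map_smul, ← hN (f _), ← mul_smul,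
      idem_mul_idem_of_ne h, zero_smul]
  refine LinearMap.ext fun x => ?_
  obtain ⟨u, rfl⟩ := Submodule.Quotient.mk_surjective _ x
  rw [← rowMatrix_smul_unitRow w u, Submodule.Quotient.mk_smul, map_smul, h0, smul_zero,
    LinearMap.zero_apply]

/-- Any property of right `A^I`-modules which is closed under extensions and which holds for zero
modules and for concentrated modules holds for all modules. -/
theorem devissage {Q : ModuleCat.{u} (D.OpAlg I) → Prop}
    (h0 : ∀ M : ModuleCat.{u} (D.OpAlg I), Subsingleton M → Q M) (hc : ∀ (M : ModuleCat.{u} (D.OpAlg I)) (z : I),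
      ConcentratedAt M z → Q M)
    (he : ∀ S : ShortComplex (ModuleCat.{u} (D.OpAlg I)), S.ShortExact → Q S.X₁ → Q S.X₃ → Q S.X₂)
    (M : ModuleCat.{u} (D.OpAlg I)) : Q M := by
  suffices h : ∀ (s : Finset I) (M : ModuleCat.{u} (D.OpAlg I)),
      (∀ m : M, ∑ z ∈ s, (idem z : D.OpAlg I) • m = m) → Q M by
    refine h Finset.univ M fun m => ?_
    rw [← Finset.sum_smul, sum_idem, one_smul]
  intro s
  induction s using Finset.strongInduction with
  | H s ih =>
    intro M hM
    rcases s.eq_empty_or_nonempty with rfl | hs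
    · exact h0 M (subsingleton_of_forall_eq 0 fun m => by rw [← hM m, Finset.sum_empty])
    -- For minimal `x` the subspace of vectors fixed by the idempotent at `x` is a submodule by
    -- triangularity, and the quotient is supported on `s.erase x`.
    obtain ⟨x, hx⟩ := s.exists_minimal hs
    let N : Submodule (D.OpAlg I) M :=
      { carrier := {m | (idem x : D.OpAlg I) • m = m}
        add_mem' := fun {m m'} h h' => by
          change (idem x : D.OpAlg I) • (m + m') = m + m'
          rw [smul_add, h, h']
        zero_mem' := smul_zero _
        smul_mem' := fun a m hm => by
          have hm' : (idem x : D.OpAlg I) • m = m := hm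
          change (idem x : D.OpAlg I) • a • m = a • m
          conv_rhs => rw [← hM (a • m)]
          refine (Finset.sum_eq_single_of_mem (f := fun z => (idem z : D.OpAlg I) • a • m) x hx.1
            fun y hy hyx => ?_).symm
          rw [← hm', ← mul_smul, ← mul_smul, idem_mul_mul_idem, zero_smul]
          exact fun hle => hyx (le_antisymm hle (hx.2 hy hle)) }
    have hS := linearShortComplex_shortExact (LinearMap.exact_subtype_mkQ N)
      N.subtype_injective N.mkQ_surjective
    refine he _ hS (hc _ x fun m => Subtype.ext m.2) (ih (s.erase x) (Finset.erase_ssubset hx.1) _ ?_)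
    intro m
    obtain ⟨m, rfl⟩ := N.mkQ_surjective m
    conv_rhs => rw [← hM m, map_sum, ← Finset.add_sum_erase _ _ hx.1]
    have : N.mkQ ((idem x : D.OpAlg I) • m) = 0 := by
      rw [Submodule.mkQ_apply, Submodule.Quotient.mk_eq_zero]
      change (idem x : D.OpAlg I) • (idem x : D.OpAlg I) • m = _
      rw [← mul_smul, idem_mul_idem]
    rw [this, zero_add]
    exact Finset.sum_congr rfl fun y _ => (map_smul _ _ _).symm

/-! ### Concentrated modules are sums of simple modules -/

/-- The scalars in the opposite algebra of `A^I`. -/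
noncomputable def scalar (D : GLData k d n) (I : Finset D.L) : k →+* D.OpAlg I where
  toFun a := OpAlg.mk (algebraMap k (Matrix I I D.R) a)
    ((D.canonicalAlgebra I).algebraMap_mem a)
  map_one' := OpAlg.ext (map_one _)
  map_mul' a b := OpAlg.ext (by
    rw [mul_comm a b]
    exact map_mul (algebraMap k (Matrix I I D.R)) b a)
  map_zero' := OpAlg.ext (map_zero _)
  map_add' a b := OpAlg.ext (map_add _ _ _)

theorem mat_scalar (a : k) (y z : I) :
    (scalar D I a).mat y z = if y = z then algebraMap k D.R a else 0 :=
  Matrix.algebraMap_matrix_apply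

theorem scalar_smul_apply (a : k) (v : D.Row I) (z : I) :
    (scalar D I a • v) z = algebraMap k D.R a * v z := by
  rw [Row.smul_apply]
  simp [mat_scalar, mul_comm]

/-- On a module concentrated at `w` only the diagonal entry of `a` at `w` acts, and it lies in `R_0
= k`. The scalar does not depend on the module, which later makes a `k`-linear map between two such
modules linear over the algebra. -/
theorem exists_scalar (w : I) (a : D.OpAlg I) : ∃ t : k, ∀ (M : Type u) [AddCommGroup M]
    [Module (D.OpAlg I) M], ConcentratedAt M w → ∀ m : M, a • m = scalar D I t • m := by
  obtain ⟨t, ht⟩ := exists_algebraMap_of_mem_component_zero (sub_self (w : D.L) ▸ a.mat_mem w w)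
  refine ⟨t, fun M _ _ hM m => ?_⟩
  have key : idem w * a * idem w = idem w * scalar D I t * idem w := by
    refine OpAlg.ext ?_
    simp only [OpAlg.mat_mul, idem, OpAlg.mat_mk, ← mul_assoc]
    rw [Matrix.single_mul_mul_single, Matrix.single_mul_mul_single, ht]
    rw [mat_scalar, if_pos rfl]
  rw [← hM (a • m), ← hM (scalar D I t • m)]
  conv_lhs => rw [← hM m]
  conv_rhs => rw [← hM m]
  rw [← mul_smul, ← mul_smul, ← mul_smul, ← mul_smul, key]

/-- A concentrated module is a `k`-vector space in disguise, and the cyclic one is a line, so a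
basis of `M` indexes the summands. -/
theorem exists_linearEquiv_of_concentratedAt {K : Ideal D.R} (hK : IsAugmentation K) {w : I}
    {M : Type u} [AddCommGroup M] [Module (D.OpAlg I) M] (hM : ConcentratedAt M w) :
    ∃ κ : Type u, Nonempty ((κ →₀ Cyc I K (w : D.L)) ≃ₗ[D.OpAlg I] M) := by
  let C := Cyc I K (w : D.L)
  let e : C := Submodule.Quotient.mk (unitRow w)
  let _ : Module k M := Module.compHom M (scalar D I)
  let _ : Module k C := Module.compHom C (scalar D I)
  have hC : ConcentratedAt C w := concentratedAt_cyc hK w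
  -- the module `C` is one-dimensional over `k`
  have he : ∀ c : C, ∃ t : k, t • e = c := by
    intro c
    obtain ⟨u, rfl⟩ := Submodule.Quotient.mk_surjective _ c
    obtain ⟨t, ht⟩ := exists_scalar w (rowMatrix w u)
    refine ⟨t, ?_⟩
    change scalar D I t • e = _
    rw [← ht C hC, ← Submodule.Quotient.mk_smul, rowMatrix_smul_unitRow]
  have he0 : ∀ t : k, t • e = 0 → t = 0 := by
    intro t ht
    have h : (Submodule.Quotient.mk (scalar D I t • unitRow w) : C) = 0 := ht
    rw [mk_eq_zero_iff] at h
    have := h w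
    rw [Submodule.coe_smul, scalar_smul_apply, unitRow_apply, if_pos rfl, mul_one] at this
    exact hK.eq_zero this
  let bC : Module.Basis Unit k C := Module.Basis.mk (v := fun _ => e)
    (linearIndependent_unique_iff.2 fun h => one_ne_zero (he0 1 (by rw [one_smul]; exact h)))
    (fun c _ => by
      obtain ⟨t, rfl⟩ := he c
      exact Submodule.smul_mem _ _ (Submodule.subset_span ⟨(), rfl⟩))
  let bM := Module.Basis.ofVectorSpace k M
  let Φ : (Module.Basis.ofVectorSpaceIndex k M →₀ C) ≃ₗ[k] M :=
    (Finsupp.mapRange.linearEquiv (bC.repr ≪≫ₗ Finsupp.uniqueLinearEquiv k k ())) ≪≫ₗ bM.repr.symm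
  refine ⟨_, ⟨{ Φ with map_smul' := fun a x => ?_ }⟩⟩
  obtain ⟨t, ht⟩ := exists_scalar w a
  have hx : a • x = t • x := ht _ (fun y => Finsupp.ext fun i => hC (y i)) x
  change Φ (a • x) = a • Φ x
  rw [ht M hM, hx]
  exact map_smul Φ t x

end GLData

namespace GLData
variable {k : Type u} [Field k] {d n : ℕ} {D : GLData k d n}

/-! ### The chain of ideals -/

/-- The ideal of `R` generated by the first `j` of the elements `X₀, …, X_{n-1}, tₙ, tₙ₊₁, …`. -/
noncomputable def chain (D : GLData k d n) (t : ℕ → D.S) (j : ℕ) : Ideal D.R :=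
  D.J {i | (i : ℕ) < j} (Ideal.span (t '' Set.Iio j))

section Chain

variable {t : ℕ → D.S}

theorem chain_eq_span (j : ℕ) : D.chain t j =
    Ideal.span (D.xR '' {i | (i : ℕ) < j} ∪ D.iota '' (t '' Set.Iio j)) := by
  rw [chain, J, Ideal.map_span, ← Ideal.span_union]

theorem chain_zero : D.chain t 0 = ⊥ := by
  have : Set.Iio (0 : ℕ) = ∅ := by ext; simp
  rw [chain_eq_span, this]
  simp

theorem isHomog_chain (hom : ∀ i, (t i).IsHomogeneous 1) (j : ℕ) : D.IsHomog (D.chain t j) := by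
  rw [chain_eq_span]
  refine isHomog_span ?_
  rintro _ (⟨i, _, rfl⟩ | ⟨_, ⟨i, _, rfl⟩, rfl⟩)
  · exact ⟨_, D.xR_mem_component i⟩
  · exact ⟨_, D.iota_mem_component (hom i)⟩

theorem ell_mem (ht : ∀ i : Fin n, t i = D.ell i) {j : ℕ} :
    ∀ i ∈ {i : Fin n | (i : ℕ) < j}, D.ell i ∈ Ideal.span (t '' Set.Iio j) := by
  intro i hi
  rw [← ht]
  exact Ideal.subset_span ⟨i, hi, rfl⟩

theorem chain_mono {i j : ℕ} (h : i ≤ j) : D.chain t i ≤ D.chain t j := by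
  rw [chain_eq_span, chain_eq_span]
  refine Ideal.span_mono (Set.union_subset_union (Set.image_mono fun l hl => ?_)
    (Set.image_mono (Set.image_mono fun l hl => ?_)))
  · exact lt_of_lt_of_le hl h
  · exact lt_of_lt_of_le hl h

/-- The form `t j` enters the chain together with `X_j`, but it is redundant since `ℓ_j = X_j ^
p_j`. -/
theorem chain_succ (ht : ∀ i : Fin n, t i = D.ell i) (j : Fin n) :
    D.chain t (j + 1) = D.chain t j ⊔ Ideal.span {D.xR j} := by
  refine le_antisymm ?_ (sup_le (chain_mono (Nat.le_succ _)) ?_)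
  · have hx : D.xR j ∈ D.chain t j ⊔ Ideal.span {D.xR j} :=
      Ideal.mem_sup_right (Ideal.mem_span_singleton_self _)
    rw [chain_eq_span (j + 1), Ideal.span_le]
    rintro _ (⟨i, hi, rfl⟩ | ⟨_, ⟨i, hi, rfl⟩, rfl⟩)
    · rcases Nat.lt_succ_iff_lt_or_eq.1 hi with h | h
      · exact Ideal.mem_sup_left (xR_mem_J h)
      · rwa [Fin.ext h]
    · rcases Nat.lt_succ_iff_lt_or_eq.1 hi with h | h
      · exact Ideal.mem_sup_left (iota_mem_J (Ideal.subset_span ⟨i, h, rfl⟩))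
      · rw [h, ht, ← xR_pow]
        exact Ideal.pow_mem_of_mem _ hx _ (D.p_pos j)
  · rw [Ideal.span_singleton_le_iff_mem]
    exact xR_mem_J (Nat.lt_succ_self (j : ℕ))

theorem chain_succ_of_le {j : ℕ} (hj : n ≤ j) :
    D.chain t (j + 1) = D.chain t j ⊔ Ideal.span {D.iota (t j)} := by
  refine le_antisymm ?_ (sup_le (chain_mono (Nat.le_succ _)) ?_)
  · rw [chain_eq_span (j + 1), Ideal.span_le]
    rintro _ (⟨i, hi, rfl⟩ | ⟨_, ⟨i, hi, rfl⟩, rfl⟩)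
    · exact Ideal.mem_sup_left (xR_mem_J (lt_of_lt_of_le i.2 hj))
    · rcases Nat.lt_succ_iff_lt_or_eq.1 hi with h | h
      · exact Ideal.mem_sup_left (iota_mem_J (Ideal.subset_span ⟨i, h, rfl⟩))
      · rw [h]
        exact Ideal.mem_sup_right (Ideal.mem_span_singleton_self _)
  · rw [Ideal.span_singleton_le_iff_mem]
    exact iota_mem_J (Ideal.subset_span ⟨j, Nat.lt_succ_self j, rfl⟩)

/-- The first `d + 1` linear forms are a regular sequence. -/
theorem mem_span_of_mul_mem
    (hspan : ∀ j, MvPolynomial.X j ∈ Submodule.span k (Set.range fun i : Fin (d + 1) => t i))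
    {j : ℕ} (hj : j ≤ d) (f : D.S) (hf : t j * f ∈ Ideal.span (t '' Set.Iio j)) :
    f ∈ Ideal.span (t '' Set.Iio j) := by
  have himg : t '' Set.Iio j = (fun i : Fin (d + 1) => t i) '' {i | (i : ℕ) < j} := by
    ext g
    constructor
    · rintro ⟨i, hi, rfl⟩
      exact ⟨⟨i, lt_trans hi (by omega)⟩, hi, rfl⟩
    · rintro ⟨i, hi, rfl⟩
      exact ⟨i, hi, rfl⟩
  rw [himg] at hf ⊢
  exact mem_span_of_basis_mul_mem hspan (i := ⟨j, by omega⟩) (by simp) hf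

/-- The first `d + 1` linear forms generate all linear forms. -/
theorem mem_span_of_isHomogeneous
    (hspan : ∀ j, MvPolynomial.X j ∈ Submodule.span k (Set.range fun i : Fin (d + 1) => t i))
    {j : ℕ} (hj : d + 1 ≤ j) {f : D.S} (hf : f.IsHomogeneous 1) :
    f ∈ Ideal.span (t '' Set.Iio j) := by
  have h1 : Submodule.span k (Set.range fun i : Fin (d + 1) => t i) ≤
      (Ideal.span (t '' Set.Iio j)).restrictScalars k := by
    rw [Submodule.span_le]
    rintro _ ⟨i, rfl⟩
    exact Ideal.subset_span ⟨i, lt_of_lt_of_le i.2 hj, rfl⟩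
  have hf' : f ∈ MvPolynomial.homogeneousSubmodule (Fin (d + 1)) k 1 := hf
  rw [MvPolynomial.homogeneousSubmodule_one_eq_span_X] at hf'
  have h2 : Submodule.span k (Set.range (MvPolynomial.X : Fin (d + 1) → D.S)) ≤
      (Ideal.span (t '' Set.Iio j)).restrictScalars k := by
    rw [Submodule.span_le]
    rintro _ ⟨i, rfl⟩
    exact h1 (hspan i)
  exact h2 hf'

theorem isAugmentation_chain (hom : ∀ i, (t i).IsHomogeneous 1)
    (hspan : ∀ j, MvPolynomial.X j ∈ Submodule.span k (Set.range fun i : Fin (d + 1) => t i))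
    {j : ℕ} (hn : n ≤ j) (hj : d + 1 ≤ j) : IsAugmentation (D.chain t j) where
  xR_mem i := xR_mem_J (lt_of_lt_of_le i.2 hn)
  iota_mem i := iota_mem_J (mem_span_of_isHomogeneous hspan hj (MvPolynomial.isHomogeneous_X k i))
  one_notMem h := by
    have hle : D.chain t j ≤ RingHom.ker D.aug := by
      rw [chain_eq_span, Ideal.span_le]
      rintro _ (⟨i, _, rfl⟩ | ⟨_, ⟨i, _, rfl⟩, rfl⟩)
      · exact aug_xR i
      · exact aug_iota (hom i)
    have := hle h
    rw [RingHom.mem_ker, map_one] at this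
    exact one_ne_zero this

theorem xR_mul_mem_chain_iff
    (ht : ∀ i : Fin n, t i = D.ell i)
    (hspan : ∀ j, MvPolynomial.X j ∈ Submodule.span k (Set.range fun i : Fin (d + 1) => t i))
    (j : Fin n) (hj : (j : ℕ) ≤ d) (r : D.R) :
    D.xR j * r ∈ D.chain t j ↔ r ∈ D.chain t j :=
  ⟨mem_J_of_xR_mul_mem (ell_mem ht) (lt_irrefl (j : ℕ))
    (fun f hf => mem_span_of_mul_mem hspan hj f (by rwa [ht])), fun h => Ideal.mul_mem_left _ _ h⟩

theorem iota_mul_mem_chain_iff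
    (ht : ∀ i : Fin n, t i = D.ell i)
    (hspan : ∀ j, MvPolynomial.X j ∈ Submodule.span k (Set.range fun i : Fin (d + 1) => t i))
    {j : ℕ} (hj : j ≤ d) (r : D.R) :
    D.iota (t j) * r ∈ D.chain t j ↔ r ∈ D.chain t j :=
  ⟨mem_J_of_iota_mul_mem (ell_mem ht) (mem_span_of_mul_mem hspan hj),
    fun h => Ideal.mul_mem_left _ _ h⟩

theorem xR_pow_mem_chain
    (hspan : ∀ j, MvPolynomial.X j ∈ Submodule.span k (Set.range fun i : Fin (d + 1) => t i))
    (j : Fin n) (hj : d + 1 ≤ (j : ℕ)) : D.xR j ^ D.p j ∈ D.chain t j := by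
  rw [xR_pow]
  exact iota_mem_J (mem_span_of_isHomogeneous hspan hj (D.ell_linear j))

/-- From index `d + 1` on, the chain contains all linear forms, so modulo it `X_j` behaves like the
variable of a truncated polynomial ring with `X_j ^ p_j = 0`. The annihilators of `X_j` and of `X_j
^ (p_j - 1)` are generated by each other; the next lemma is the other half. -/
theorem xR_mul_mem_chain_iff_mem_sup
    (ht : ∀ i : Fin n, t i = D.ell i)
    (hspan : ∀ j, MvPolynomial.X j ∈ Submodule.span k (Set.range fun i : Fin (d + 1) => t i))
    (j : Fin n) (hj : d + 1 ≤ (j : ℕ)) (r : D.R) :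
    D.xR j * r ∈ D.chain t j ↔ r ∈ D.chain t j ⊔ Ideal.span {D.xR j ^ (D.p j - 1)} := by
  refine ⟨mem_J_sup_of_xR_mul_mem (ell_mem ht) (lt_irrefl (j : ℕ)), fun h => ?_⟩
  obtain ⟨s, hs, u, hu, rfl⟩ := Submodule.mem_sup.1 h
  obtain ⟨v, rfl⟩ := Ideal.mem_span_singleton'.1 hu
  rw [mul_add, mul_left_comm, ← pow_succ', Nat.sub_add_cancel (D.p_pos j)]
  exact add_mem (Ideal.mul_mem_left _ _ hs) (Ideal.mul_mem_left _ _ (xR_pow_mem_chain hspan j hj))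

theorem xR_pow_mul_mem_chain_iff
    (ht : ∀ i : Fin n, t i = D.ell i)
    (hspan : ∀ j, MvPolynomial.X j ∈ Submodule.span k (Set.range fun i : Fin (d + 1) => t i))
    (j : Fin n) (hj : d + 1 ≤ (j : ℕ)) (r : D.R) :
    D.xR j ^ (D.p j - 1) * r ∈ D.chain t j ↔ r ∈ D.chain t (j + 1) := by
  rw [chain_succ ht]
  refine ⟨mem_J_sup_of_xR_pow_mul_mem (ell_mem ht) (lt_irrefl (j : ℕ)), fun h => ?_⟩
  obtain ⟨s, hs, u, hu, rfl⟩ := Submodule.mem_sup.1 h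
  obtain ⟨v, rfl⟩ := Ideal.mem_span_singleton'.1 hu
  rw [mul_add, mul_left_comm, ← pow_succ, Nat.sub_add_cancel (D.p_pos j)]
  exact add_mem (Ideal.mul_mem_left _ _ hs) (Ideal.mul_mem_left _ _ (xR_pow_mem_chain hspan j hj))

end Chain

/-! ### Extensions of cyclic modules -/

variable {I : Finset D.L}

/-- `Extⁱ((R / K)(w), N)` is nonzero. -/
def CycExt (K : Ideal D.R) (w : D.L) (N : ModuleCat.{u} (D.OpAlg I)) (i : ℕ) : Prop :=
  ExtNonzero (ModuleCat.of (D.OpAlg I) (Cyc I K w)) N i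

section CycExt

variable {K K' : Ideal D.R} {g : D.R} {y w : D.L} {N : ModuleCat.{u} (D.OpAlg I)} {i : ℕ}

theorem CycExt.of_sup (h : CycExt (K ⊔ Ideal.span {g}) w N i) (hK : D.IsHomog K)
    (hg : g ∈ D.component y) (hK' : ∀ r, g * r ∈ K ↔ r ∈ K') :
    CycExt K w N i ∨ ∃ j, i = j + 1 ∧ CycExt K' (w - y) N j := by
  obtain ⟨f, f', hex, hinj, hsurj⟩ := exists_exact_cyc (I := I) hK hg hK' w
  exact ExtNonzero.of_X₃ (linearShortComplex_shortExact hex hinj hsurj) h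

theorem CycExt.sup_of_colon (h : CycExt K' (w - y) N i) (hK : D.IsHomog K)
    (hg : g ∈ D.component y) (hK' : ∀ r, g * r ∈ K ↔ r ∈ K') (h' : ¬ CycExt K w N i) :
    CycExt (K ⊔ Ideal.span {g}) w N (i + 1) := by
  obtain ⟨f, f', hex, hinj, hsurj⟩ := exists_exact_cyc (I := I) hK hg hK' w
  exact ExtNonzero.X₃_of_X₁ (linearShortComplex_shortExact hex hinj hsurj) h h'

theorem CycExt.sup_of_self (h : CycExt K w N i) (hK : D.IsHomog K)
    (hg : g ∈ D.component y) (hK' : ∀ r, g * r ∈ K ↔ r ∈ K') (h' : ¬ CycExt K' (w - y) N i) :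
    CycExt (K ⊔ Ideal.span {g}) w N i := by
  obtain ⟨f, f', hex, hinj, hsurj⟩ := exists_exact_cyc (I := I) hK hg hK' w
  exact ExtNonzero.X₃_of_X₂ (linearShortComplex_shortExact hex hinj hsurj) h h'

end CycExt

theorem not_extNonzero_of_subsingleton {B : Type u} [Ring B] {M N : ModuleCat.{u} B}
    [Subsingleton M] {i : ℕ} : ¬ ExtNonzero M N i :=
  hasProjectiveDimensionLT_iff_extNonzero.1
    (ModuleCat.isZero_of_subsingleton M).hasProjectiveDimensionLT_zero i (Nat.zero_le i) N

/-- In the first case of `hw` the module is the projective at `w`; in the second it is zero. This is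
where the shape of `I` enters. -/
theorem CycExt.of_bot {w : D.L} (hw : w ∈ I ∨ ∀ z ∈ I, ¬ z ≤ w) {N : ModuleCat.{u} (D.OpAlg I)}
    {v : I} (hN : ConcentratedAt N v) {i : ℕ} (h : CycExt ⊥ w N i) : w = v ∧ i = 0 := by
  rcases hw with hw | hw
  · lift w to I using hw
    have := cyc_bot_projective w
    have hi : i = 0 := ExtNonzero.eq_zero_of_projective h
    subst hi
    refine ⟨?_, rfl⟩
    by_contra hne
    obtain ⟨f, hf⟩ := extNonzero_zero_iff.1 h
    exact hf (eq_zero_of_concentratedAt (fun h => hne (congrArg _ h)) hN f)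
  · have : Subsingleton (Cyc I (⊥ : Ideal D.R) w) := subsingleton_cyc hw
    exact absurd h (not_extNonzero_of_subsingleton
      (M := ModuleCat.of (D.OpAlg I) (Cyc I (⊥ : Ideal D.R) w)))

theorem cycExt_bot {K : Ideal D.R} (hK : IsAugmentation K) (v : I) :
    CycExt (⊥ : Ideal D.R) (v : D.L) (ModuleCat.of (D.OpAlg I) (Cyc I K (v : D.L))) 0 := by
  rw [CycExt, extNonzero_zero_iff]
  have hle : (row I (⊥ : Ideal D.R) (v : D.L)).comap (row I (⊤ : Ideal D.R) (v : D.L)).subtype ≤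
      (row I K (v : D.L)).comap (row I (⊤ : Ideal D.R) (v : D.L)).subtype :=
    fun u hu z => ⟨bot_le (a := K) (hu z).1, (hu z).2⟩
  refine ⟨Submodule.factor hle, fun h => ?_⟩
  have h1 : (Submodule.Quotient.mk (unitRow v) : Cyc I K (v : D.L)) = 0 :=
    LinearMap.congr_fun h (Submodule.Quotient.mk (unitRow v))
  rw [mk_eq_zero_iff] at h1
  have := h1 v
  rw [unitRow_apply, if_pos rfl] at this
  exact hK.one_notMem this

end GLData

namespace GLData
variable {k : Type u} [Field k] {d n : ℕ} {D : GLData k d n}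

/-! ### Degrees of the minimal resolutions -/

/-- The element `a c + ∑_{l ∈ s} x_l` of `L`. -/
noncomputable def elt (D : GLData k d n) (a : ℕ) (s : Finset (Fin n)) : D.L :=
  a • D.c + ∑ l ∈ s, D.x l

/-- Coefficients `0` and `1` are smaller than `pᵢ ≥ 2`, so these elements are in normal form. The
internal degree therefore fixes the homological degree, and unwanted neighbours in the long exact
sequences vanish. -/
theorem elt_inj {a a' : ℕ} {s s' : Finset (Fin n)} (h : D.elt a s = D.elt a' s') :
    a = a' ∧ s = s' := by
  have nf : ∀ (a : ℕ) (s : Finset (Fin n)),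
      D.IsNormalForm (D.elt a s) a fun i => if i ∈ s then 1 else 0 := by
    intro a s
    refine ⟨fun i => ?_, ?_⟩
    · have := D.two_le_p i
      dsimp only
      split_ifs <;> omega
    · simp [elt, ite_smul]
  obtain ⟨h1, h2⟩ := D.isNormalForm_unique (nf a s) (h ▸ nf a' s')
  refine ⟨by exact_mod_cast h1, Finset.ext fun i => ?_⟩
  have := congrFun h2 i
  by_cases hi : i ∈ s <;> by_cases hi' : i ∈ s' <;> simp_all

theorem elt_insert (a : ℕ) {s : Finset (Fin n)} {j : Fin n} (hj : j ∉ s) :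
    D.elt a (insert j s) = D.elt a s + D.x j := by
  rw [elt, elt, Finset.sum_insert hj]
  abel

theorem elt_succ (a : ℕ) (s : Finset (Fin n)) : D.elt (a + 1) s = D.elt a s + D.c := by
  rw [elt, elt, succ_nsmul]
  abel

theorem x_mem_Lpos (i : Fin n) : D.x i ∈ D.Lpos := weight_mem_Lpos (Sum.inr i)

theorem c_mem_Lpos : D.c ∈ D.Lpos := weight_mem_Lpos (Sum.inl 0)

theorem sub_le_of_le {w y z : D.L} (h : w ≤ y) (hz : z ∈ D.Lpos) : w - z ≤ y := by
  rw [le_iff] at *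
  rw [show y - (w - z) = y - w + z by abel]
  exact add_mem h hz

/-- Degrees in the Koszul complex of the first `j` of the elements `Xᵢ`. -/
def koszulTable (D : GLData k d n) (j : ℕ) (u : D.L) (i : ℕ) : Prop :=
  ∃ s : Finset (Fin n), (∀ l ∈ s, (l : ℕ) < j) ∧ u = D.elt 0 s ∧ i = s.card

/-- Degrees in the Koszul complex of the elements `Xᵢ` and `j - n` elements of degree `c`. -/
def fullKoszulTable (D : GLData k d n) (j : ℕ) (u : D.L) (i : ℕ) : Prop :=
  ∃ (a : ℕ) (s : Finset (Fin n)), a ≤ j - n ∧ u = D.elt a s ∧ i = a + s.card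

/-- Degrees in the Tate resolution involving the first `j` of the elements `Xᵢ`. -/
def tateTable (D : GLData k d n) (j : ℕ) (u : D.L) (i : ℕ) : Prop :=
  ∃ (a : ℕ) (s : Finset (Fin n)), (∀ l ∈ s, (l : ℕ) < j) ∧ u = D.elt a s ∧ i = 2 * a + s.card

/-- All nonzero `Extⁱ((R / K)(w), N)` with `N` concentrated at `v` satisfy `T (w - v) i`. -/
def VanishesOutside (I : Finset D.L) (y : D.L) (K : Ideal D.R) (T : D.L → ℕ → Prop) : Prop :=
  ∀ w ≤ y, ∀ (v : I) (N : ModuleCat.{u} (D.OpAlg I)), ConcentratedAt N v →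
    ∀ i, CycExt K w N i → T (w - v) i

/-- All `Extⁱ((R / K)(w), (R / M)(v))` with `T (w - v) i` are nonzero. -/
def NonzeroOn (I : Finset D.L) (y : D.L) (M K : Ideal D.R) (T : D.L → ℕ → Prop) : Prop :=
  ∀ w ≤ y, ∀ (v : I) (i : ℕ), T (w - v) i →
    CycExt K w (ModuleCat.of (D.OpAlg I) (Cyc I M (v : D.L))) i

variable {I : Finset D.L} {y : D.L} {M : Ideal D.R}

/-- The degree `w` ranges over everything below `y`, not only over `I`, because later steps replace
`w` by `w - deg g`, which may leave `I`. -/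
theorem vanishesOutside_bot (hI : ∀ w ≤ y, w ∈ I ∨ ∀ z ∈ I, ¬ z ≤ w) :
    VanishesOutside I y ⊥ (D.koszulTable 0) := by
  intro w hw v N hN i h
  obtain ⟨rfl, rfl⟩ := CycExt.of_bot (hI w hw) hN h
  exact ⟨∅, by simp, by simp [elt], rfl⟩

theorem nonzeroOn_bot (hM : IsAugmentation M) : NonzeroOn I y M ⊥ (D.koszulTable 0) := by
  rintro w - v i ⟨s, hs, hu, rfl⟩
  have hs0 : s = ∅ := Finset.eq_empty_of_forall_notMem fun l hl => absurd (hs l hl) (by omega)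
  subst hs0
  have : w = v := by simpa [elt, sub_eq_zero] using hu
  subst this
  exact cycExt_bot hM v

theorem koszulTable_succ {j : Fin n} {u : D.L} {i : ℕ} (h : D.koszulTable j u i) :
    D.koszulTable (j + 1) u i := by
  obtain ⟨s, hs, hu, hi⟩ := h
  exact ⟨s, fun l hl => Nat.lt_succ_of_lt (hs l hl), hu, hi⟩

/-! ### Adjoining one generator to the ideal -/

section Steps

variable {K : Ideal D.R}

/-- A nonzero class comes either from `w`, leaving `s` unchanged, or from `w - x_j` one degree
lower, which adds `j` to `s`. -/
theorem vanishesOutside_koszul_succ {j : Fin n} (hK : D.IsHomog K)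
    (hreg : ∀ r, D.xR j * r ∈ K ↔ r ∈ K) (h : VanishesOutside I y K (D.koszulTable j)) :
    VanishesOutside I y (K ⊔ Ideal.span {D.xR j}) (D.koszulTable (j + 1)) := by
  intro w hw v N hN i hi
  rcases hi.of_sup hK (D.xR_mem_component j) hreg with hi | ⟨i, rfl, h₁⟩
  · exact koszulTable_succ (h w hw v N hN i hi)
  · obtain ⟨s, hs, hu, rfl⟩ := h _ (sub_le_of_le hw (x_mem_Lpos j)) v N hN i h₁
    have hj : j ∉ s := fun hj => lt_irrefl _ (hs j hj)
    refine ⟨insert j s, ?_, ?_, (Finset.card_insert_of_notMem hj).symm⟩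
    · intro l hl
      rcases Finset.mem_insert.1 hl with rfl | hl
      · exact Nat.lt_succ_self _
      · exact Nat.lt_succ_of_lt (hs l hl)
    · rw [elt_insert 0 hj, ← hu]
      abel

theorem lt_of_lt_succ_of_notMem {j : Fin n} {s : Finset (Fin n)} (hs : ∀ l ∈ s, (l : ℕ) < j + 1)
    {l : Fin n} (hl : l ∈ s) (hlj : l ≠ j) : (l : ℕ) < j :=
  lt_of_le_of_ne (Nat.lt_succ_iff.1 (hs l hl)) fun h => hlj (Fin.ext h)

/-- If `j ∈ s`, the class comes from `w - x_j` by the connecting map; if not, it comes from `w`. The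
group that could obstruct vanishes, because by `elt_inj` it would require `j` to be on the other
side. -/
theorem nonzeroOn_koszul_succ {j : Fin n} (hM : IsAugmentation M) (hK : D.IsHomog K)
    (hreg : ∀ r, D.xR j * r ∈ K ↔ r ∈ K) (h : VanishesOutside I y K (D.koszulTable j))
    (h' : NonzeroOn I y M K (D.koszulTable j)) :
    NonzeroOn I y M (K ⊔ Ideal.span {D.xR j}) (D.koszulTable (j + 1)) := by
  rintro w hw v _ ⟨s, hs, hu, rfl⟩
  have hN := concentratedAt_cyc hM v
  have hwx := sub_le_of_le hw (x_mem_Lpos j)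
  by_cases hj : j ∈ s
  · have hcard := Finset.card_erase_add_one hj
    rw [← hcard]
    have hu' : w - D.x j - v = D.elt 0 (s.erase j) := by
      rw [sub_right_comm, hu, sub_eq_iff_eq_add, ← elt_insert 0 (Finset.notMem_erase j s),
        Finset.insert_erase hj]
    refine (h' _ hwx v _ ⟨s.erase j, fun l hl => ?_, hu', rfl⟩).sup_of_colon hK
      (D.xR_mem_component j) hreg fun hc => ?_
    · rw [Finset.mem_erase] at hl
      exact lt_of_lt_succ_of_notMem hs hl.2 hl.1
    · obtain ⟨s', hs', hu', -⟩ := h w hw v _ hN _ hc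
      obtain ⟨-, rfl⟩ := elt_inj (hu.symm.trans hu')
      exact lt_irrefl _ (hs' j hj)
  · refine (h' w hw v _ ⟨s, fun l hl => ?_, hu, rfl⟩).sup_of_self hK
      (D.xR_mem_component j) hreg fun hc => ?_
    · exact lt_of_lt_succ_of_notMem hs hl fun h => hj (h ▸ hl)
    · obtain ⟨s', hs', hu', -⟩ := h _ hwx v _ hN _ hc
      have hj' : j ∉ s' := fun hj => lt_irrefl _ (hs' j hj)
      rw [sub_right_comm, hu, sub_eq_iff_eq_add, ← elt_insert 0 hj'] at hu'
      exact hj ((elt_inj hu').2 ▸ Finset.mem_insert_self _ _)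

theorem vanishesOutside_fullKoszul_succ {j : ℕ} (hj : n ≤ j) {g : D.R} (hg : g ∈ D.component D.c)
    (hK : D.IsHomog K) (hreg : ∀ r, g * r ∈ K ↔ r ∈ K)
    (h : VanishesOutside I y K (D.fullKoszulTable j)) :
    VanishesOutside I y (K ⊔ Ideal.span {g}) (D.fullKoszulTable (j + 1)) := by
  intro w hw v N hN i hi
  rcases hi.of_sup hK hg hreg with hi | ⟨i, rfl, h₁⟩
  · obtain ⟨a, s, ha, hu, hi⟩ := h w hw v N hN i hi
    exact ⟨a, s, by omega, hu, hi⟩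
  · obtain ⟨a, s, ha, hu, rfl⟩ := h _ (sub_le_of_le hw c_mem_Lpos) v N hN i h₁
    refine ⟨a + 1, s, by omega, ?_, by omega⟩
    rw [elt_succ, ← hu]
    abel

/-- For `a ≤ j - n` the class comes from `w`, and the obstruction at `w - c` sits in a different
homological degree. The new value `a = j - n + 1` comes from `w - c`, and the bound on `a` rules out
the obstruction at `w`. -/
theorem nonzeroOn_fullKoszul_succ {j : ℕ} (hj : n ≤ j) {g : D.R} (hg : g ∈ D.component D.c)
    (hM : IsAugmentation M) (hK : D.IsHomog K) (hreg : ∀ r, g * r ∈ K ↔ r ∈ K)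
    (h : VanishesOutside I y K (D.fullKoszulTable j))
    (h' : NonzeroOn I y M K (D.fullKoszulTable j)) :
    NonzeroOn I y M (K ⊔ Ideal.span {g}) (D.fullKoszulTable (j + 1)) := by
  rintro w hw v _ ⟨a, s, ha, hu, rfl⟩
  have hN := concentratedAt_cyc hM v
  have hwc := sub_le_of_le hw c_mem_Lpos
  by_cases haj : a ≤ j - n
  · refine (h' w hw v _ ⟨a, s, haj, hu, rfl⟩).sup_of_self hK hg hreg fun hc => ?_
    obtain ⟨a', s', ha', hu', hi⟩ := h _ hwc v _ hN _ hc
    rw [sub_right_comm, hu, sub_eq_iff_eq_add, ← elt_succ] at hu'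
    obtain ⟨rfl, rfl⟩ := elt_inj hu'
    omega
  · obtain ⟨a, rfl⟩ := Nat.exists_eq_succ_of_ne_zero (show a ≠ 0 by omega)
    have hu' : w - D.c - v = D.elt a s := by
      rw [sub_right_comm, hu, sub_eq_iff_eq_add, ← elt_succ]
    rw [show a.succ + s.card = a + s.card + 1 by omega]
    refine (h' _ hwc v _ ⟨a, s, by omega, hu', rfl⟩).sup_of_colon hK hg hreg fun hc => ?_
    obtain ⟨a', s', ha', hu', -⟩ := h w hw v _ hN _ hc
    obtain ⟨rfl, -⟩ := elt_inj (hu.symm.trans hu')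
    omega

theorem sub_x_sub_nsmul (w : D.L) (j : Fin n) :
    w - D.x j - (D.p j - 1) • D.x j = w - D.c := by
  rw [sub_sub, ← succ_nsmul', Nat.sub_add_cancel (D.p_pos j), p_smul_x]

variable {K' H : Ideal D.R} {j : Fin n}

/-- The sequences for `X_j` on `R/K` at `w` and for `X_j ^ (p_j - 1)` on `R/K` at `w - x_j` are
spliced at `R/H`. They lead from `R/K'` at `w` back to `R/K'` at `w - c`, two homological degrees
lower. -/
theorem vanishesOutside_tate_succ (hK : D.IsHomog K)
    (hH : H = K ⊔ Ideal.span {D.xR j ^ (D.p j - 1)}) (hK' : K' = K ⊔ Ideal.span {D.xR j})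
    (hcol : ∀ r, D.xR j * r ∈ K ↔ r ∈ H)
    (hcol' : ∀ r, D.xR j ^ (D.p j - 1) * r ∈ K ↔ r ∈ K')
    (h : VanishesOutside I y K (D.tateTable j)) :
    VanishesOutside I y K' (D.tateTable (j + 1)) := by
  intro w hw v N hN i
  -- Since the recursion returns to the same ideal `K'`, it is run on the homological degree.
  induction i using Nat.strong_induction_on generalizing w with
  | _ i ih =>
    intro hi
    have hwx := sub_le_of_le hw (x_mem_Lpos j)
    rw [hK'] at hi
    rcases hi.of_sup hK (D.xR_mem_component j) hcol with hi | ⟨i, rfl, h₁⟩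
    · obtain ⟨a, s, hs, hu, hi⟩ := h w hw v N hN i hi
      exact ⟨a, s, fun l hl => Nat.lt_succ_of_lt (hs l hl), hu, hi⟩
    rw [hH] at h₁
    rcases h₁.of_sup hK (D.xR_pow_mem_component j _) hcol' with h₁ | ⟨i, rfl, h₂⟩
    · obtain ⟨a, s, hs, hu, rfl⟩ := h _ hwx v N hN i h₁
      have hj : j ∉ s := fun hj => lt_irrefl _ (hs j hj)
      refine ⟨a, insert j s, ?_, ?_, by rw [Finset.card_insert_of_notMem hj, add_assoc]⟩
      · intro l hl
        rcases Finset.mem_insert.1 hl with rfl | hl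
        · exact Nat.lt_succ_self _
        · exact Nat.lt_succ_of_lt (hs l hl)
      · rw [elt_insert a hj, ← hu]
        abel
    · rw [sub_x_sub_nsmul] at h₂
      obtain ⟨a, s, hs, hu, rfl⟩ := ih i (by omega) _ (sub_le_of_le hw c_mem_Lpos) h₂
      refine ⟨a + 1, s, hs, ?_, by omega⟩
      rw [elt_succ, ← hu]
      abel

/-- Only the part `a = 0` of the table of `K` has to be nonzero: one periodic step already raises
`a` to any value. For `a = 0` all terms at `w - c` vanish. For larger `a` the class is transported
from `w - c` by two connecting maps, whose obstructions lie in the wrong homological degree. -/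
theorem nonzeroOn_tate_succ (hM : IsAugmentation M) (hK : D.IsHomog K)
    (hH : H = K ⊔ Ideal.span {D.xR j ^ (D.p j - 1)}) (hK' : K' = K ⊔ Ideal.span {D.xR j})
    (hcol : ∀ r, D.xR j * r ∈ K ↔ r ∈ H)
    (hcol' : ∀ r, D.xR j ^ (D.p j - 1) * r ∈ K ↔ r ∈ K')
    (h : VanishesOutside I y K (D.tateTable j)) (h' : NonzeroOn I y M K (D.koszulTable j)) :
    NonzeroOn I y M K' (D.tateTable (j + 1)) := by
  have hv := vanishesOutside_tate_succ hK hH hK' hcol hcol' h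
  rintro w hw v _ ⟨a, s, hs, hu, rfl⟩
  have hN := concentratedAt_cyc hM v
  induction a generalizing w with
  | zero =>
    rw [mul_zero, zero_add]
    have hwx := sub_le_of_le hw (x_mem_Lpos j)
    have hwc := sub_le_of_le hw c_mem_Lpos
    have hG : ∀ i, ¬ CycExt K' (w - D.c) (ModuleCat.of (D.OpAlg I) (Cyc I M (v : D.L))) i := by
      intro i hc
      obtain ⟨a', s', hs', hu', -⟩ := hv _ hwc v _ hN _ hc
      rw [sub_right_comm, hu, sub_eq_iff_eq_add, ← elt_succ] at hu'
      have := (elt_inj hu').1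
      omega
    by_cases hj : j ∈ s
    · have hcard := Finset.card_erase_add_one hj
      rw [← hcard, hK']
      have hu' : w - D.x j - v = D.elt 0 (s.erase j) := by
        rw [sub_right_comm, hu, sub_eq_iff_eq_add, ← elt_insert 0 (Finset.notMem_erase j s),
          Finset.insert_erase hj]
      refine CycExt.sup_of_colon ?_ hK (D.xR_mem_component j) hcol fun hc => ?_
      · rw [hH]
        refine CycExt.sup_of_self (h' _ hwx v _ ⟨s.erase j, fun l hl => ?_, hu', rfl⟩) hK
          (D.xR_pow_mem_component j _) hcol' ?_
        · rw [Finset.mem_erase] at hl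
          exact lt_of_lt_succ_of_notMem hs hl.2 hl.1
        · rw [sub_x_sub_nsmul]
          exact hG _
      · obtain ⟨a', s', hs', hu', -⟩ := h w hw v _ hN _ hc
        obtain ⟨-, rfl⟩ := elt_inj (hu.symm.trans hu')
        exact lt_irrefl _ (hs' j hj)
    · rw [hK']
      refine (h' w hw v _ ⟨s, fun l hl => ?_, hu, rfl⟩).sup_of_self hK
        (D.xR_mem_component j) hcol fun hc => ?_
      · exact lt_of_lt_succ_of_notMem hs hl fun h => hj (h ▸ hl)
      · rw [hH] at hc
        rcases hc.of_sup hK (D.xR_pow_mem_component j _) hcol' with hc | ⟨i, -, hc⟩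
        · obtain ⟨a', s', hs', hu', -⟩ := h _ hwx v _ hN _ hc
          have hj' : j ∉ s' := fun hj => lt_irrefl _ (hs' j hj)
          rw [sub_right_comm, hu, sub_eq_iff_eq_add, ← elt_insert a' hj'] at hu'
          exact hj ((elt_inj hu').2 ▸ Finset.mem_insert_self _ _)
        · rw [sub_x_sub_nsmul] at hc
          exact hG _ hc
  | succ a ih =>
    have hwx := sub_le_of_le hw (x_mem_Lpos j)
    have hu' : w - D.c - v = D.elt a s := by
      rw [sub_right_comm, hu, sub_eq_iff_eq_add, ← elt_succ]
    have hG := ih _ (sub_le_of_le hw c_mem_Lpos) hu'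
    rw [show 2 * (a + 1) + s.card = 2 * a + s.card + 1 + 1 by omega, hK']
    refine CycExt.sup_of_colon ?_ hK (D.xR_mem_component j) hcol fun hc => ?_
    · rw [hH]
      refine CycExt.sup_of_colon ?_ hK (D.xR_pow_mem_component j _) hcol' fun hc => ?_
      · rwa [sub_x_sub_nsmul]
      · obtain ⟨a', s', hs', hu', hi⟩ := h _ hwx v _ hN _ hc
        have hj' : j ∉ s' := fun hj => lt_irrefl _ (hs' j hj)
        rw [sub_right_comm, hu, sub_eq_iff_eq_add, ← elt_insert a' hj'] at hu'
        obtain ⟨rfl, rfl⟩ := elt_inj hu'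
        rw [Finset.card_insert_of_notMem hj'] at hi
        omega
    · obtain ⟨a', s', hs', hu', hi⟩ := h w hw v _ hN _ hc
      obtain ⟨rfl, rfl⟩ := elt_inj (hu.symm.trans hu')
      omega

end Steps

end GLData

namespace GLData
variable {k : Type u} [Field k] {d n : ℕ} {D : GLData k d n} {I : Finset D.L} {y : D.L}

/-! ### Ext tables of the residue field -/

section Tables

variable {t : ℕ → D.S}

theorem koszul_chain (ht : ∀ i : Fin n, t i = D.ell i) (hom : ∀ i, (t i).IsHomogeneous 1)
    (hspan : ∀ j, MvPolynomial.X j ∈ Submodule.span k (Set.range fun i : Fin (d + 1) => t i))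
    (hI : ∀ w ≤ y, w ∈ I ∨ ∀ z ∈ I, ¬ z ≤ w) {M : Ideal D.R} (hM : IsAugmentation M) (j : ℕ) :
    j ≤ n → j ≤ d + 1 → VanishesOutside I y (D.chain t j) (D.koszulTable j) ∧
      NonzeroOn I y M (D.chain t j) (D.koszulTable j) := by
  induction j with
  | zero =>
    intro _ _
    rw [chain_zero]
    exact ⟨vanishesOutside_bot hI, nonzeroOn_bot hM⟩
  | succ j ih =>
    intro hj hjd
    obtain ⟨h, h'⟩ := ih (by omega) (by omega)
    have hK := isHomog_chain (D := D) hom j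
    have hreg := xR_mul_mem_chain_iff ht hspan ⟨j, hj⟩ (by simp; omega)
    have hs := chain_succ ht ⟨j, hj⟩
    dsimp only at hs
    rw [hs]
    exact ⟨vanishesOutside_koszul_succ (j := ⟨j, hj⟩) hK hreg h,
      nonzeroOn_koszul_succ (j := ⟨j, hj⟩) hM hK hreg h h'⟩

theorem fullKoszulTable_iff {u : D.L} {i : ℕ} : D.fullKoszulTable n u i ↔ D.koszulTable n u i := by
  constructor
  · rintro ⟨a, s, ha, hu, hi⟩
    obtain rfl : a = 0 := by omega
    exact ⟨s, fun l _ => l.2, hu, by omega⟩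
  · rintro ⟨s, -, hu, hi⟩
    exact ⟨0, s, Nat.zero_le _, hu, by omega⟩

theorem exists_augmentation_of_le (hI : ∀ w ≤ y, w ∈ I ∨ ∀ z ∈ I, ¬ z ≤ w) (hn : n ≤ d + 1) :
    ∃ M : Ideal D.R, IsAugmentation M ∧ VanishesOutside I y M (D.fullKoszulTable (d + 1)) ∧
      NonzeroOn I y M M (D.fullKoszulTable (d + 1)) := by
  obtain ⟨t, ht, hom, hspan⟩ := D.exists_linearForms
  have hM := isAugmentation_chain hom hspan hn le_rfl
  refine ⟨_, hM, ?_⟩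
  suffices h : ∀ j, n ≤ j → j ≤ d + 1 →
      VanishesOutside I y (D.chain t j) (D.fullKoszulTable j) ∧
      NonzeroOn I y (D.chain t (d + 1)) (D.chain t j) (D.fullKoszulTable j) from h _ hn le_rfl
  intro j hj
  induction j, hj using Nat.le_induction with
  | base =>
    intro _
    obtain ⟨h, h'⟩ := koszul_chain ht hom hspan hI hM n le_rfl hn
    exact ⟨fun w hw v N hN i hi => fullKoszulTable_iff.2 (h w hw v N hN i hi),
      fun w hw v i hi => h' w hw v i (fullKoszulTable_iff.1 hi)⟩
  | succ j hj ih =>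
    intro hjd
    obtain ⟨h, h'⟩ := ih (by omega)
    have hK := isHomog_chain (D := D) hom j
    have hreg := iota_mul_mem_chain_iff ht hspan (show j ≤ d by omega)
    have hg := D.iota_mem_component (hom j)
    rw [chain_succ_of_le hj]
    exact ⟨vanishesOutside_fullKoszul_succ hj hg hK hreg h,
      nonzeroOn_fullKoszul_succ hj hg hM hK hreg h h'⟩

theorem tateTable_of_koszulTable {j : ℕ} {u : D.L} {i : ℕ} (h : D.koszulTable j u i) :
    D.tateTable j u i := by
  obtain ⟨s, hs, hu, hi⟩ := h
  exact ⟨0, s, hs, hu, by omega⟩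

theorem exists_augmentation_of_lt (hI : ∀ w ≤ y, w ∈ I ∨ ∀ z ∈ I, ¬ z ≤ w) (hn : d + 2 ≤ n) :
    ∃ M : Ideal D.R, IsAugmentation M ∧ VanishesOutside I y M (D.tateTable n) ∧
      NonzeroOn I y M M (D.tateTable n) := by
  obtain ⟨t, ht, hom, hspan⟩ := D.exists_linearForms
  have hM := isAugmentation_chain hom hspan le_rfl (show d + 1 ≤ n by omega)
  refine ⟨_, hM, ?_⟩
  -- The induction starts at `d + 2`: the first `d + 1` generators are a regular sequence and give a
  -- finite Koszul complex, so terms with `a > 0` appear only with the first periodic step.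
  suffices h : ∀ j, d + 2 ≤ j → j ≤ n →
      VanishesOutside I y (D.chain t j) (D.tateTable j) ∧
      NonzeroOn I y (D.chain t n) (D.chain t j) (D.tateTable j) from h _ hn le_rfl
  have step : ∀ j, d + 1 ≤ j → j + 1 ≤ n → VanishesOutside I y (D.chain t j) (D.tateTable j) →
      NonzeroOn I y (D.chain t n) (D.chain t j) (D.koszulTable j) →
      VanishesOutside I y (D.chain t (j + 1)) (D.tateTable (j + 1)) ∧
      NonzeroOn I y (D.chain t n) (D.chain t (j + 1)) (D.tateTable (j + 1)) := by
    intro j hjd hj h h'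
    have hK := isHomog_chain (D := D) hom j
    have hcol := xR_mul_mem_chain_iff_mem_sup ht hspan ⟨j, hj⟩ hjd
    have hcol' := xR_pow_mul_mem_chain_iff ht hspan ⟨j, hj⟩ hjd
    have hs := chain_succ ht ⟨j, hj⟩
    exact ⟨vanishesOutside_tate_succ (j := ⟨j, hj⟩) hK rfl hs hcol hcol' h,
      nonzeroOn_tate_succ (j := ⟨j, hj⟩) hM hK rfl hs hcol hcol' h h'⟩
  intro j hj
  induction j, hj using Nat.le_induction with
  | base =>
    intro _
    obtain ⟨h, h'⟩ := koszul_chain ht hom hspan hI hM (d + 1) (by omega) le_rfl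
    exact step _ le_rfl hn (fun w hw v N hN i hi => tateTable_of_koszulTable (h w hw v N hN i hi)) h'
  | succ j hj ih =>
    intro hjn
    obtain ⟨h, h'⟩ := ih (by omega)
    exact step j (by omega) hjn h fun w hw v i hi => h' w hw v i (tateTable_of_koszulTable hi)

end Tables

/-! ### The global dimension -/

/-- The upper bound reduces to simple modules in both arguments of `Ext`; the lower bound is
attained by the simple module at the top vertex `y`. -/
theorem rightGlobalDimension_eq {M : Ideal D.R} (hM : IsAugmentation M) {T : D.L → ℕ → Prop}
    (hV : VanishesOutside I y M T) (hN : NonzeroOn I y M M T) (hy : ∀ w ∈ I, w ≤ y) {g : ℕ}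
    (hle : ∀ w ∈ I, ∀ v ∈ I, ∀ i, T (w - v) i → i ≤ g) (hge : ∃ v ∈ I, T (y - v) g) :
    rightGlobalDimension (D.canonicalAlgebra I) = g := by
  change (⨆ N : ModuleCat.{u} (D.OpAlg I), projectiveDimension N) = g
  refine le_antisymm (iSup_le fun N => ?_) ?_
  · rw [projectiveDimension_le_iff]
    refine devissage (Q := fun N => HasProjectiveDimensionLT N (g + 1)) ?_ ?_ ?_ N
    · intro N hN
      have := (ModuleCat.isZero_of_subsingleton N).hasProjectiveDimensionLT_zero
      exact hasProjectiveDimensionLT_of_ge N 0 (g + 1) (Nat.zero_le _)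
    · intro N w hw
      obtain ⟨κ, ⟨e⟩⟩ := exists_linearEquiv_of_concentratedAt hM hw
      have hC : HasProjectiveDimensionLT (ModuleCat.of (D.OpAlg I) (Cyc I M (w : D.L))) (g + 1) := by
        rw [hasProjectiveDimensionLT_iff_extNonzero]
        intro i hi N
        -- A second dévissage, now in the target: vanishing of `Extⁱ` from a fixed module is closed
        -- under extensions.
        refine devissage (Q := fun N => ¬ ExtNonzero _ N i) ?_ ?_ ?_ N
        · rintro N hN ⟨e, he⟩
          exact he (((ModuleCat.isZero_of_subsingleton N).eq_of_tgt (𝟙 N) 0 |> fun h => by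
            rw [← e.comp_mk₀_id, h, Abelian.Ext.mk₀_zero, Abelian.Ext.comp_zero]))
        · intro N v hN h
          have := hle w w.2 v v.2 i (hV w (hy w w.2) v N hN i h)
          omega
        · intro S hS h₁ h₃ h₂
          rcases h₂.of_covariant_X₂ hS with h | h
          · exact h₁ h
          · exact h₃ h
      have := hasProjectiveDimensionLT_finsupp κ (g + 1) _ hC
      exact hasProjectiveDimensionLT_of_iso e.toModuleIso (g + 1)
    · intro S hS h₁ h₃
      exact hS.hasProjectiveDimensionLT_X₂ _ h₁ h₃
  · obtain ⟨v, hv, hT⟩ := hge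
    refine le_iSup_of_le (ModuleCat.of (D.OpAlg I) (Cyc I M y)) ?_
    rw [projectiveDimension_ge_iff, hasProjectiveDimensionLT_iff_extNonzero]
    exact fun h => h g le_rfl _ (hN y le_rfl ⟨v, hv⟩ g hT)

/-! ### Normal forms -/

theorem isNormalForm_of_nat (a : ℤ) (m : Fin n → ℕ) :
    D.IsNormalForm (a • D.c + ∑ l, m l • D.x l) (a + ∑ l, ((m l / D.p l : ℕ) : ℤ))
      fun l => m l % D.p l := by
  refine ⟨fun l => Nat.mod_lt _ (D.p_pos l), ?_⟩
  rw [add_smul, Finset.sum_smul, add_assoc, ← Finset.sum_add_distrib]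
  congr 1
  refine Finset.sum_congr rfl fun l _ => ?_
  rw [natCast_zsmul, ← D.p_smul_x l, ← mul_nsmul, ← add_nsmul, mul_comm, mul_comm (m l / D.p l),
    Nat.div_add_mod]

theorem elt_eq_sum (a : ℕ) (s : Finset (Fin n)) :
    D.elt a s = a • D.c + ∑ l, (if l ∈ s then 1 else 0) • D.x l := by
  simp [elt, ite_smul]

/-- Here `q` counts the carries `p_l x_l = c` made when `elt a' s + z` is brought to normal form.
Each `l ∈ s` with `b l = 0` forces a carry. -/
theorem card_le_of_eq_elt_add {a : ℤ} {b : Fin n → ℕ} (hy : D.IsNormalForm y a b) {a' : ℕ}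
    {s : Finset (Fin n)} {z : D.L} (hz : z ∈ D.Lpos) (h : y = D.elt a' s + z) :
    ∃ q : ℕ, (a' : ℤ) + q ≤ a ∧ s.card ≤ (Finset.univ.filter fun i => b i ≠ 0).card + q := by
  obtain ⟨e, m, rfl⟩ := D.mem_Lpos hz
  have h1 : y = ((a' + e : ℕ) : ℤ) • D.c + ∑ l, (m l + if l ∈ s then 1 else 0) • D.x l := by
    rw [h, elt_eq_sum, natCast_zsmul]
    simp only [add_smul, Finset.sum_add_distrib]
    abel
  have h2 := D.isNormalForm_of_nat ((a' + e : ℕ) : ℤ) fun l => m l + if l ∈ s then 1 else 0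
  rw [← h1] at h2
  obtain ⟨ha, hb⟩ := D.isNormalForm_unique hy h2
  refine ⟨∑ l, (m l + if l ∈ s then 1 else 0) / D.p l, ?_, ?_⟩
  · rw [ha]
    push_cast
    omega
  · rw [Finset.card_filter, ← Finset.sum_add_distrib]
    have : s.card = ∑ l, if l ∈ s then 1 else 0 := by simp
    rw [this]
    refine Finset.sum_le_sum fun l _ => ?_
    have hbl := congrFun hb l
    by_cases hl : l ∈ s
    · simp only [hl, if_true] at hbl ⊢
      by_cases hb0 : b l = 0
      -- The exponent `m l + 1` is positive and divisible by `p l`, so its quotient is at least one.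
      · have := Nat.div_add_mod (m l + 1) (D.p l)
        rw [← hbl, hb0] at this
        have h0 : (m l + 1) / D.p l ≠ 0 := by
          intro h0
          rw [h0] at this
          omega
        exact (Nat.pos_of_ne_zero h0).trans_le (Nat.le_add_left _ _)
      · simp [hb0]
    · simp [hl]

/-- A converse to the carry count: for each `l ∈ s` with `b l = 0` one copy of `c` is broken up as
`p_l x_l` before `x_l` is subtracted. -/
theorem sub_elt_mem_Lpos {a : ℕ} {b : Fin n → ℕ} (hy : D.IsNormalForm y a b) {a' : ℕ}
    {s : Finset (Fin n)} (h : a' + (s.filter fun l => b l = 0).card ≤ a) :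
    y - D.elt a' s ∈ D.Lpos := by
  obtain ⟨e, rfl⟩ := Nat.exists_eq_add_of_le h
  have key : ∀ l, b l + (if l ∈ s ∧ b l = 0 then D.p l else 0) = (if l ∈ s then 1 else 0) +
      (if l ∈ s then (if b l = 0 then D.p l - 1 else b l - 1) else b l) := by
    intro l
    have := D.p_pos l
    by_cases hl : l ∈ s <;> by_cases hb : b l = 0 <;> simp [hl, hb] <;> omega
  have hc : (s.filter fun l => b l = 0).card • D.c =
      ∑ l, (if l ∈ s ∧ b l = 0 then D.p l else 0) • D.x l := by
    simp only [ite_smul, zero_smul, p_smul_x]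
    rw [← Finset.sum_filter, Finset.sum_const]
    congr 2
    ext l
    simp
  have hyz : y - D.elt a' s = e • D.c +
      ∑ l, (if l ∈ s then (if b l = 0 then D.p l - 1 else b l - 1) else b l) • D.x l := by
    rw [sub_eq_iff_eq_add, hy.2, elt_eq_sum, natCast_zsmul, add_smul, add_smul, hc]
    have := Finset.sum_congr (rfl : (Finset.univ : Finset (Fin n)) = Finset.univ)
      fun l _ => congrArg (fun m : ℕ => m • D.x l) (key l)
    simp only [add_smul, Finset.sum_add_distrib] at this
    rw [show ∀ p q r s : D.L, p + q + r + s = p + r + (s + q) by intros; abel, this]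
    abel
  rw [hyz]
  exact add_mem (AddSubmonoid.nsmul_mem _ c_mem_Lpos _)
    (AddSubmonoid.sum_mem _ fun l _ => AddSubmonoid.nsmul_mem _ (x_mem_Lpos l) _)

theorem elt_mem_Lpos (a : ℕ) (s : Finset (Fin n)) : D.elt a s ∈ D.Lpos :=
  add_mem (AddSubmonoid.nsmul_mem _ c_mem_Lpos _) (AddSubmonoid.sum_mem _ fun l _ => x_mem_Lpos l)

theorem IsNormalForm.nonneg {a : ℤ} {b : Fin n → ℕ} (h : D.IsNormalForm y a b)
    (hy : y ∈ D.Lpos) : 0 ≤ a := by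
  obtain ⟨q, hq, -⟩ := card_le_of_eq_elt_add h (a' := 0) (s := ∅) hy (by simp [elt])
  omega

theorem mem_Icc_or (w : D.L) :
    w ≤ y → w ∈ Finset.Icc 0 y ∨ ∀ z ∈ Finset.Icc 0 y, ¬ z ≤ w := by
  intro hw
  by_cases h0 : 0 ≤ w
  · exact Or.inl (Finset.mem_Icc.2 ⟨h0, hw⟩)
  · exact Or.inr fun z hz hzw => h0 ((Finset.mem_Icc.1 hz).1.trans hzw)

theorem exists_add_of_mem_Icc {w v u : D.L} (hw : w ∈ Finset.Icc 0 y) (hv : v ∈ Finset.Icc 0 y)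
    (h : w - v = u) : ∃ z ∈ D.Lpos, y = u + z := by
  have hw' : y - w ∈ D.Lpos := (Finset.mem_Icc.1 hw).2
  have hv' : v - 0 ∈ D.Lpos := (Finset.mem_Icc.1 hv).1
  rw [sub_zero] at hv'
  exact ⟨y - w + v, add_mem hw' hv', by rw [← h]; abel⟩

theorem sub_elt_mem_Icc {a' : ℕ} {s : Finset (Fin n)} (h : y - D.elt a' s ∈ D.Lpos) :
    y - D.elt a' s ∈ Finset.Icc 0 y := by
  refine Finset.mem_Icc.2 ⟨?_, ?_⟩
  · rwa [le_iff, sub_zero]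
  · rw [le_iff, sub_sub_cancel]
    exact elt_mem_Lpos _ _

theorem rightGlobalDimension_of_lt {a : ℕ} {b : Fin n → ℕ} (hy : D.IsNormalForm y a b)
    (hn : d + 2 ≤ n) : rightGlobalDimension (D.canonicalAlgebra (Finset.Icc 0 y)) =
      ((2 * a + (Finset.univ.filter fun i => b i ≠ 0).card : ℕ) : WithBot ℕ∞) := by
  obtain ⟨M, hM, hV, hN⟩ := exists_augmentation_of_lt (mem_Icc_or (y := y)) hn
  refine rightGlobalDimension_eq hM hV hN (fun w hw => (Finset.mem_Icc.1 hw).2) ?_ ?_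
  · rintro w hw v hv i ⟨a', s, -, hu, rfl⟩
    obtain ⟨z, hz, hyz⟩ := exists_add_of_mem_Icc hw hv hu
    -- Each carry costs two in `2 * a'` and gains at most one in `s.card`, so the optimum has no
    -- carries: `a' = a` and `s` the support of `b`.
    obtain ⟨q, hq, hq'⟩ := card_le_of_eq_elt_add hy hz hyz
    omega
  · refine ⟨y - D.elt a (Finset.univ.filter fun i => b i ≠ 0),
      sub_elt_mem_Icc (sub_elt_mem_Lpos hy ?_), a, _, fun l _ => l.2, sub_sub_cancel _ _, rfl⟩
    rw [Finset.filter_filter]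
    simp

theorem rightGlobalDimension_of_le {a : ℕ} {b : Fin n → ℕ} (hy : D.IsNormalForm y a b)
    (hn : n ≤ d + 1) : rightGlobalDimension (D.canonicalAlgebra (Finset.Icc 0 y)) =
      ((min (d + 1) (a + (Finset.univ.filter fun i => b i ≠ 0).card) : ℕ) : WithBot ℕ∞) := by
  obtain ⟨M, hM, hV, hN⟩ := exists_augmentation_of_le (mem_Icc_or (y := y)) hn
  refine rightGlobalDimension_eq hM hV hN (fun w hw => (Finset.mem_Icc.1 hw).2) ?_ ?_
  · rintro w hw v hv i ⟨a', s, ha', hu, rfl⟩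
    obtain ⟨z, hz, hyz⟩ := exists_add_of_mem_Icc hw hv hu
    obtain ⟨q, hq, hq'⟩ := card_le_of_eq_elt_add hy hz hyz
    have := s.card_le_univ
    rw [Fintype.card_fin] at this
    exact le_min (by omega) (by omega)
  · set s₀ := Finset.univ.filter fun i => b i ≠ 0 with hs₀
    have hcard := s₀.card_le_univ
    rw [Fintype.card_fin] at hcard
    -- As many `c` as possible, at most `d + 1 - n`, are used for `a'`. Each remaining one buys an
    -- index outside the support `s₀`, until all `n` indices are used.
    obtain ⟨s, hs, -, hsc⟩ := Finset.exists_subsuperset_card_eq (n := s₀.card +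
      min (a - min a (d + 1 - n)) (n - s₀.card)) s₀.subset_univ (by omega)
      (by rw [Finset.card_univ, Fintype.card_fin]; omega)
    have hsd : (s.filter fun l => b l = 0).card + s₀.card = s.card := by
      rw [← Finset.card_filter_add_card_filter_not (s := s) fun l => b l = 0]
      congr 2
      ext l
      simp only [hs₀, Finset.mem_filter, Finset.mem_univ, true_and]
      exact ⟨fun h => ⟨hs (by simpa [hs₀] using h), h⟩, fun h => h.2⟩
    refine ⟨y - D.elt (min a (d + 1 - n)) s, sub_elt_mem_Icc (sub_elt_mem_Lpos hy (by omega)),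
      min a (d + 1 - n), s, by omega, sub_sub_cancel _ _, by omega⟩

/-- Writing `-2 xᵢ = (pᵢ - 2) xᵢ - c` for every `i` leaves `d + 2 (n - d - 1) - n = n - d - 2`
copies of `c`. -/
theorem isNormalForm_cm (D : GLData k d n) (hn : d + 2 ≤ n) :
    D.IsNormalForm (d • D.c + 2 • D.omega) ((n - d - 2 : ℕ) : ℤ) fun i => D.p i - 2 := by
  refine ⟨fun i => Nat.sub_lt (by have := D.two_le_p i; omega) two_pos, ?_⟩
  have h1 : ∑ i, (D.p i - 2) • D.x i + 2 • ∑ i, D.x i = n • D.c := by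
    rw [Finset.smul_sum, ← Finset.sum_add_distrib]
    have : ∀ i, (D.p i - 2) • D.x i + 2 • D.x i = D.c := fun i => by
      rw [← add_smul, Nat.sub_add_cancel (D.two_le_p i), p_smul_x]
    simp [this]
  rw [← eq_sub_iff_add_eq] at h1
  rw [h1, omega, smul_sub]
  obtain ⟨e, rfl⟩ := Nat.exists_eq_add_of_le hn
  have h2 : ((d + 2 + e : ℕ) : ℤ) - d - 1 = (e + 1 : ℕ) := by push_cast; ring
  rw [h2, natCast_zsmul, natCast_zsmul, show d + 2 + e - d - 2 = e by omega]
  simp only [add_smul, one_smul, two_smul]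
  abel

end GLData

/-! ### The global dimension formulas -/

theorem mainTheorem8 {k : Type u} [Field k] {d n : ℕ} (hd : 1 ≤ d) (D : GLData k d n) :
    (∀ y ∈ D.Lpos, ∀ (a : ℤ) (b : Fin n → ℕ), D.IsNormalForm y a b →
      ∃ g : ℕ, rightGlobalDimension (D.canonicalAlgebra (Finset.Icc 0 y)) = g ∧
        (n ≤ d + 1 →
          (g : ℤ) = min ((d : ℤ) + 1) (a + (Finset.univ.filter fun i => b i ≠ 0).card)) ∧
        (d + 2 ≤ n →
          (g : ℤ) = 2 * a + (Finset.univ.filter fun i => b i ≠ 0).card)) ∧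
    (d + 2 ≤ n →
      ∃ g : ℕ, rightGlobalDimension D.cmCanonicalAlgebra = g ∧
        (g : ℤ) = 2 * ((n : ℤ) - d - 2) +
          (Finset.univ.filter fun i => 3 ≤ D.p i).card) := by
  constructor
  · intro y hy a b h
    lift a to ℕ using h.nonneg hy
    by_cases hn : n ≤ d + 1
    · exact ⟨_, GLData.rightGlobalDimension_of_le h hn, fun _ => by push_cast; rfl,
        fun hn' => absurd hn (by omega)⟩
    · exact ⟨_, GLData.rightGlobalDimension_of_lt h (by omega), fun hn' => absurd hn' hn,
        fun _ => by push_cast; rfl⟩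
  · intro hn
    refine ⟨_, GLData.rightGlobalDimension_of_lt (D.isNormalForm_cm hn) hn, ?_⟩
    have : (Finset.univ.filter fun i => D.p i - 2 ≠ 0) = Finset.univ.filter fun i => 3 ≤ D.p i := by
      ext i
      simp only [Finset.mem_filter, Finset.mem_univ, true_and]
      omega
    rw [this]
    push_cast
    omega
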